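/- Let $\pi\colon E\to M$ be a fibration (a smooth surjective submersion; in particular, any smooth fibre bundle) of an $(m+n)$-dimensional manifold $E$ onto an $m$-dimensional manifold $M$, and let $\eta$ be a volume form on $M$. Use adapted coordinates $(x^i,u^\alpha)$ on $E$. Write $J^1\pi$ for the first jet bundle, whose points over $u\in E$ are the linear maps $z\colon T_{\pi(u)}M\to T_uE$ with $T_u\pi\circ z=\mathrm{id}$, with coordinates $(x^i,u^\alpha,u^\alpha_i)$; $\nu\colon\mathcal M\pi=\Lambda^m_2E\to E$ for the bundle of $m$-forms on $E$ that vanish on any two $\pi$-vertical vectors, with coordinates $(x^i,u^\alpha,p,p^i_\alpha)$ such that $\omega=p\,d^mx+p^i_\alpha\,du^\alpha\wedge d^{m-1}x_i$, where $d^{m-1}x_i=i_{\partial/\partial x^i}d^mx$; $\mu\colon\mathcal M\pi\to\mathcal M^\circ\pi=\Lambda^m_2E/\Lambda^m_1E$ for the quotient by the forms that vanish on any one vertical vector; $\Theta$ for the tautological $m$-form on $\mathcal M\pi$ and $\Omega=-d\Theta$. On $J^1(\pi\circ\nu)$, the first jet bundle of $\pi\circ\nu\colon\mathcal M\pi\to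 M$, use the coordinates $(x^i,u^\alpha,p,p^i_\alpha,u^\alpha_j,p_j,p^i_{\alpha j})$. Let $\mathcal L=L\eta$, with $L\colon J^1\pi\to\mathbb R$ smooth, be a Lagrangian density. Its Legendre transforms $\mathrm{Leg}_{\mathcal L}\colon J^1\pi\to\mathcal M\pi$ and $\mathrm{leg}_{\mathcal L}=\mu\circ\mathrm{Leg}_{\mathcal L}$ are defined by the condition that the pullback of the form $\mathrm{Leg}_{\mathcal L}(z)$ to $T_zJ^1\pi$ is the Poincaré–Cartan form $\Theta_{\mathcal L}=L\eta+\frac{\partial L}{\partial u^\alpha_i}(du^\alpha-u^\alpha_j\,dx^j)\wedge i_{\partial/\partial x^i}\eta$ at $z$. Assume that $\mathcal L$ is hyperregular, that is, that $\mathrm{leg}_{\mathcal L}\colon J^1\pi\to\mathcal M^\circ\pi$ is a diffeomorphism, and let $$\mathcal H(\omega)=\langle\omega,\mathrm{leg}_{\mathcal L}^{-1}(\mu(\omega))\rangle\,\eta-\mathcal L\bigl(\mathrm{leg}_{\mathcal L}^{-1}(\mu(\omega))\bigr),\qquad \omega\in\mathcal M\pi,$$ be the associated Hamiltonian density, where $\langle\omega,z\rangle\eta=z^*\omega$.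 The densities $\mathcal L$ and $\mathcal H$ are regarded as semibasic $m$-forms on $J^1\pi$ and on $\mathcal M\pi$, and $d\mathcal L$, $d\mathcal H$ are their exterior derivatives. Let $A_\pi^\eta\colon J^1(\pi\circ\nu)\to\Lambda^{m+1}J^1\pi$ be the Tulczyjew morphism over $j^1\nu\colon J^1(\pi\circ\nu)\to J^1\pi$, given in any natural coordinates by $$(x^i,u^\alpha,p,p^i_\alpha,u^\alpha_j,p_j,p^i_{\alpha j})\longmapsto(p^i_{\alpha i}\,du^\alpha+p^i_\alpha\,du^\alpha_i)\wedge d^mx ,$$ and let $\flat_\Omega\colon J^1(\pi\circ\nu)\to\Lambda^{m+1}\mathcal M\pi$ be given over $\omega\in\mathcal M\pi$ by $\flat_\Omega(\bar z)=i_{h_{\bar z}}\Omega(\omega)-(m-1)\,\Omega(\omega)$, where $h_{\bar z}=\bar z\circ T_\omega(\pi\circ\nu)$ and $(i_h\Omega)(X_1,\dots,X_{m+1})=\sum_{i}\Omega(X_1,\dots,h(X_i),\dots,X_{m+1})$. Then the subsets $$S_{\mathcal L}=(A_\pi^\eta)^{-1}\bigl(d\mathcal L(J^1\pi)\bigr)\qquad\text{and}\qquad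 S_{\mathcal H}=\flat_\Omega^{-1}\bigl(-d\mathcal H(\mathcal M\pi)\bigr)$$ of $J^1(\pi\circ\nu)$ are equal. -/

import Mathlib

open scoped Manifold ContDiff Topology
open Set

noncomputable section

namespace CFT

/-- The Euclidean space `ℝᵏ`. -/
abbrev Rn (k : ℕ) : Type := EuclideanSpace ℝ (Fin k)

/-! ### Linear algebra of forms -/

section Alternating

variable {V W : Type*} [AddCommGroup V] [Module ℝ V] [TopologicalSpace V]
  [AddCommGroup W] [Module ℝ W] [TopologicalSpace W]

/-- The derivation `i_T β` induced on a `k`-form `β` by an endomorphism `T`: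
`(i_T β)(v₁, …, v_k) = ∑ᵢ β(v₁, …, T vᵢ, …, v_k)`. -/
def derivAction {k : ℕ} (T : V →L[ℝ] V) (β : V [⋀^Fin k]→L[ℝ] ℝ) : V [⋀^Fin k]→L[ℝ] ℝ where
  toFun v := ∑ i, β (Function.update v i (T (v i)))
  map_update_add' {inst} v j x y := by
    obtain rfl : inst = instDecidableEqFin k := Subsingleton.elim _ _
    rw [← Finset.sum_add_distrib]
    refine Finset.sum_congr rfl fun i _ => ?_
    rcases eq_or_ne i j with rfl | h
    · simp
    · simp only [Function.update_of_ne h, Function.update_comm h.symm,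
        ContinuousAlternatingMap.map_update_add]
  map_update_smul' {inst} v j c x := by
    obtain rfl : inst = instDecidableEqFin k := Subsingleton.elim _ _
    rw [Finset.smul_sum]
    refine Finset.sum_congr rfl fun i _ => ?_
    rcases eq_or_ne i j with rfl | h
    · simp
    · simp only [Function.update_of_ne h, Function.update_comm h.symm,
        ContinuousAlternatingMap.map_update_smul]
  map_eq_zero_of_eq' v a b hv hab := by
    rw [Finset.sum_eq_add_of_mem a b (Finset.mem_univ _) (Finset.mem_univ _) hab]
    · have h2 : Function.update v b (T (v b)) =
          (Function.update v a (T (v a))) ∘ Equiv.swap a b := by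
        ext l
        rcases eq_or_ne l a with rfl | hla
        · simp [hab, hab.symm, hv]
        · rcases eq_or_ne l b with rfl | hlb
          · simp [hv]
          · simp [Function.update_of_ne hla, Function.update_of_ne hlb,
              Equiv.swap_apply_of_ne_of_ne hla hlb]
      rw [h2]
      have := β.toAlternatingMap.map_swap (Function.update v a (T (v a))) hab
      simp only [ContinuousAlternatingMap.coe_toAlternatingMap] at this
      rw [this]; simp
    · intro c _ hc
      exact β.map_eq_zero_of_eq _ (by
        simp [Function.update_of_ne hc.1.symm, Function.update_of_ne hc.2.symm, hv]) hab
  cont := by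
    refine continuous_finsetSum _ fun i _ => β.cont.comp ?_
    exact continuous_id.update i (T.continuous.comp (continuous_apply i))

theorem derivAction_apply {k : ℕ} (T : V →L[ℝ] V) (β : V [⋀^Fin k]→L[ℝ] ℝ) (v : Fin k → V) :
    derivAction T β v = ∑ i, β (Function.update v i (T (v i))) := rfl

/-- The `k`-forms that are `r`-horizontal with respect to `p`: those that vanish as soon as `r` of
their arguments are vertical, that is, lie in the kernel of `p`. -/
def horizontal (p : V →L[ℝ] W) (r k : ℕ) : Submodule ℝ (V [⋀^Fin k]→L[ℝ] ℝ) where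
  carrier := {β | ∀ (v : Fin k → V) (s : Finset (Fin k)), s.card = r →
    (∀ i ∈ s, p (v i) = 0) → β v = 0}
  add_mem' h₁ h₂ v s hs hv := by simp [h₁ v s hs hv, h₂ v s hs hv]
  zero_mem' _ _ _ _ := rfl
  smul_mem' c β h v s hs hv := by simp [h v s hs hv]

theorem mem_horizontal {p : V →L[ℝ] W} {r k : ℕ} {β : V [⋀^Fin k]→L[ℝ] ℝ} :
    β ∈ horizontal p r k ↔ ∀ (v : Fin k → V) (s : Finset (Fin k)), s.card = r →
      (∀ i ∈ s, p (v i) = 0) → β v = 0 := Iff.rfl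

/-- Two `2`-horizontal forms are identified when they differ by a `1`-horizontal form. -/
def redSetoid (p : V →L[ℝ] W) (k : ℕ) : Setoid (horizontal p 2 k) where
  r β γ := β.1 - γ.1 ∈ horizontal p 1 k
  iseqv :=
    { refl := fun β => by rw [sub_self]; exact Submodule.zero_mem _
      symm := fun {β γ} h => by rw [← neg_sub]; exact Submodule.neg_mem _ h
      trans := fun {β γ δ} h h' => by
        rw [← sub_add_sub_cancel β.1 γ.1 δ.1]; exact Submodule.add_mem _ h h' }

/-- The quotient of the space of `2`-horizontal `k`-forms by the subspace of `1`-horizontal ones. -/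
def RedForms (p : V →L[ℝ] W) (k : ℕ) : Type _ := Quotient (redSetoid p k)

namespace RedForms

variable {p : V →L[ℝ] W} {k : ℕ}

/-- The class of a `2`-horizontal form. -/
def mk (β : horizontal p 2 k) : RedForms p k := Quotient.mk (redSetoid p k) β

/-- A representative of a class. -/
def out (b : RedForms p k) : horizontal p 2 k := Quotient.out b

theorem mk_out (b : RedForms p k) : mk b.out = b := Quotient.out_eq b

theorem mk_eq {β γ : horizontal p 2 k} : mk β = mk γ ↔ β.1 - γ.1 ∈ horizontal p 1 k :=
  Quotient.eq (r := redSetoid p k)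

end RedForms

end Alternating

/-- The standard volume form `dᵐx` of `ℝᵐ`. -/
def stdVol (m : ℕ) : Rn m [⋀^Fin m]→L[ℝ] ℝ :=
  { (EuclideanSpace.basisFun (Fin m) ℝ).toBasis.det with
    cont := by
      change Continuous fun v : Fin m → Rn m =>
        (EuclideanSpace.basisFun (Fin m) ℝ).toBasis.det v
      simp only [Module.Basis.det_apply]
      refine Continuous.matrix_det (continuous_matrix fun i j => ?_)
      simp only [Module.Basis.toMatrix_apply, OrthonormalBasis.coe_toBasis_repr_apply,
        EuclideanSpace.basisFun_repr]
      fun_prop }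

/-- The `i`-th standard basis vector of `ℝᵏ`. -/
abbrev stdBasis {k : ℕ} (i : Fin k) : Rn k := EuclideanSpace.single i 1

theorem stdVol_basis (m : ℕ) : stdVol m stdBasis = 1 := by
  have h := (EuclideanSpace.basisFun (Fin m) ℝ).toBasis.det_self
  have h2 : ⇑(EuclideanSpace.basisFun (Fin m) ℝ).toBasis = (stdBasis : Fin m → Rn m) := by
    ext i; simp [stdBasis]
  rw [h2] at h
  exact h

theorem stdVol_update (m : ℕ) (i : Fin m) (ξ : Rn m) :
    stdVol m (Function.update stdBasis i ξ) = ξ i := by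
  have h : ξ = ∑ j, ξ j • (stdBasis j : Rn m) := by
    ext l; simp [stdBasis, Finset.sum_apply, Pi.single_apply]
  conv_lhs => rw [h]
  have hs := (stdVol m).toMultilinearMap.map_update_sum Finset.univ i
    (fun j => ξ j • (stdBasis j : Rn m)) stdBasis
  change stdVol m _ = ∑ j, stdVol m _ at hs
  rw [hs, Finset.sum_eq_single i]
  · simp [stdVol_basis]
  · intro j _ hj
    rw [ContinuousAlternatingMap.map_update_smul, (stdVol m).map_eq_zero_of_eq _ _ hj]
    · simp
    · simp [Function.update_of_ne hj]
  · simp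

/-! ### Adapted coordinates on forms -/

section Model

variable (m n : ℕ)

/-- The space of adapted coordinates `(xⁱ, uᵅ)`. -/
abbrev Adap : Type := Rn m × Rn n

variable {m n}

/-- The coordinate vector `∂/∂xⁱ`. -/
abbrev dX (i : Fin m) : Adap m n := (stdBasis i, 0)

/-- The coordinate vector `∂/∂uᵅ`. -/
abbrev dU (a : Fin n) : Adap m n := (0, stdBasis a)

/-- The endomorphism `∑ pⁱ_α duᵅ ⊗ ∂/∂xⁱ`. -/
def momEndo (P : Fin m → Fin n → ℝ) : Adap m n →L[ℝ] Adap m n :=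
  ∑ i, ∑ a, P i a •
    (((EuclideanSpace.proj a : Rn n →L[ℝ] ℝ).comp (ContinuousLinearMap.snd ℝ (Rn m) (Rn n))).smulRight
      (dX i : Adap m n))

/-- The `m`-form `p dᵐx + ∑ pⁱ_α duᵅ ∧ dᵐ⁻¹xᵢ`. -/
def coordForm (q : ℝ × (Fin m → Fin n → ℝ)) : Adap m n [⋀^Fin m]→L[ℝ] ℝ :=
  q.1 • (stdVol m).compContinuousLinearMap (ContinuousLinearMap.fst ℝ (Rn m) (Rn n)) +
    derivAction (momEndo q.2)
      ((stdVol m).compContinuousLinearMap (ContinuousLinearMap.fst ℝ (Rn m) (Rn n)))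

/-- The coordinates `(p, pⁱ_α)` of an `m`-form. -/
def formCoord (β : Adap m n [⋀^Fin m]→L[ℝ] ℝ) : ℝ × (Fin m → Fin n → ℝ) :=
  (β dX, fun i a => β (Function.update dX i (dU a)))

theorem momEndo_apply (P : Fin m → Fin n → ℝ) (v : Adap m n) :
    momEndo P v = ∑ i, ∑ a, (P i a * v.2 a) • (dX i : Adap m n) := by
  simp [momEndo, mul_smul]

theorem momEndo_fst (P : Fin m → Fin n → ℝ) (v : Adap m n) (i : Fin m) :
    (momEndo P v).1 i = ∑ a, P i a * v.2 a := by
  simp [momEndo_apply, Prod.fst_sum, stdBasis, Pi.single_apply, Finset.sum_comm (γ := Fin m)]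

theorem coordForm_apply (q : ℝ × (Fin m → Fin n → ℝ)) (v : Fin m → Adap m n) :
    coordForm q v = q.1 * stdVol m (fun i => (v i).1) +
      ∑ k, stdVol m (Function.update (fun i => (v i).1) k (momEndo q.2 (v k)).1) := by
  simp only [coordForm, ContinuousAlternatingMap.add_apply, ContinuousAlternatingMap.smul_apply,
    ContinuousAlternatingMap.compContinuousLinearMap_apply, derivAction_apply, smul_eq_mul]
  congr 1
  refine Finset.sum_congr rfl fun k _ => ?_
  congr 1
  ext l : 1
  rcases eq_or_ne l k with rfl | h
  · simp
  · simp [Function.update_of_ne h]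

theorem coordForm_mem (q : ℝ × (Fin m → Fin n → ℝ)) :
    coordForm q ∈ horizontal (ContinuousLinearMap.fst ℝ (Rn m) (Rn n)) 2 m := by
  rw [mem_horizontal]
  intro v s hs hv
  obtain ⟨i, j, hij, rfl⟩ := Finset.card_eq_two.1 hs
  have hi : (v i).1 = 0 := hv i (by simp)
  have hj : (v j).1 = 0 := hv j (by simp)
  rw [coordForm_apply, (stdVol m).map_eq_zero_of_eq _ (hi.trans hj.symm) hij, mul_zero, zero_add]
  refine Finset.sum_eq_zero fun k _ => ?_
  rcases eq_or_ne k i with rfl | hk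
  · exact (stdVol m).map_coord_zero j (by simp [Function.update_of_ne hij.symm, hj])
  · exact (stdVol m).map_coord_zero i (by simp [Function.update_of_ne hk.symm, hi])

theorem formCoord_coordForm (q : ℝ × (Fin m → Fin n → ℝ)) : formCoord (coordForm q) = q := by
  refine Prod.ext ?_ ?_
  · simp only [formCoord, coordForm_apply]
    rw [Finset.sum_eq_zero]
    · change q.1 * stdVol m stdBasis + 0 = q.1
      rw [stdVol_basis]; simp
    · intro k _
      exact (stdVol m).map_coord_zero k (by simp [momEndo_apply])
  · ext i a
    simp only [formCoord, coordForm_apply]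
    rw [(stdVol m).map_coord_zero i (by simp), mul_zero, zero_add, Finset.sum_eq_single i]
    · have : (Function.update (fun l => ((Function.update dX i (dU a) : Fin m → Adap m n) l).1) i
          (momEndo q.2 ((Function.update dX i (dU a) : Fin m → Adap m n) i)).1) =
          Function.update stdBasis i (momEndo q.2 (dU a)).1 := by
        ext l : 1
        rcases eq_or_ne l i with rfl | h
        · simp
        · simp [Function.update_of_ne h]
      rw [this, stdVol_update, momEndo_fst]
      simp [stdBasis]
    · intro k _ hk
      exact (stdVol m).map_coord_zero k (by simp [Function.update_of_ne hk, momEndo_apply])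
    · simp

theorem eq_zero_of_formCoord {β : Adap m n [⋀^Fin m]→L[ℝ] ℝ}
    (hβ : β ∈ horizontal (ContinuousLinearMap.fst ℝ (Rn m) (Rn n)) 2 m)
    (h : formCoord β = 0) : β = 0 := by
  have h1 : β dX = 0 := congrArg Prod.fst h
  have h2 : ∀ i a, β (Function.update dX i (dU a)) = 0 := fun i a =>
    congrFun (congrFun (congrArg Prod.snd h) i) a
  let b : Module.Basis (Fin m ⊕ Fin n) ℝ (Adap m n) :=
    (EuclideanSpace.basisFun (Fin m) ℝ).toBasis.prod (EuclideanSpace.basisFun (Fin n) ℝ).toBasis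
  have bl : ∀ i, b (Sum.inl i) = dX i := fun i => by simp [b]
  have br : ∀ a, b (Sum.inr a) = dU a := fun i => by simp [b]
  apply ContinuousAlternatingMap.toAlternatingMap_injective
  refine Module.Basis.ext_alternating b fun v hv => ?_
  change β (fun i => b (v i)) = 0
  by_cases hall : ∀ i, ∃ a, v i = Sum.inl a
  · choose σ hσ using hall
    have hinj : Function.Injective σ := fun i j hij => hv (by rw [hσ, hσ, hij])
    let e : Equiv.Perm (Fin m) := Equiv.ofBijective σ (Finite.injective_iff_bijective.1 hinj)
    have : (fun i => b (v i)) = (dX : Fin m → Adap m n) ∘ e := by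
      ext1 i; simp [hσ, bl, e]
    rw [this]
    have := β.toAlternatingMap.map_perm (dX : Fin m → Adap m n) e
    simp only [ContinuousAlternatingMap.coe_toAlternatingMap] at this
    rw [this, h1, smul_zero]
  · push Not at hall
    obtain ⟨k, hk⟩ := hall
    obtain ⟨a, ha⟩ : ∃ a, v k = Sum.inr a := by
      rcases hvk : v k with i | a
      · exact absurd hvk (hk i)
      · exact ⟨a, rfl⟩
    by_cases hone : ∀ i, i ≠ k → ∃ a, v i = Sum.inl a
    · choose! τ hτ using hone
      obtain ⟨i, -, hi⟩ : ∃ i ∈ (Finset.univ : Finset (Fin m)),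
          i ∉ (Finset.univ.erase k).image τ := by
        apply Finset.exists_mem_notMem_of_card_lt_card
        calc ((Finset.univ.erase k).image τ).card ≤ (Finset.univ.erase k).card :=
              Finset.card_image_le
          _ < (Finset.univ : Finset (Fin m)).card := Finset.card_erase_lt_of_mem (Finset.mem_univ k)
      have hi' : ∀ l, l ≠ k → τ l ≠ i := fun l hl h =>
        hi (Finset.mem_image.2 ⟨l, by simp [hl], h⟩)
      let σ : Fin m → Fin m := Function.update τ k i
      have hinj : Function.Injective σ := by
        intro x y hxy
        rcases eq_or_ne x k with rfl | hx <;> rcases eq_or_ne y x with rfl | hyx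
        · rfl
        · simp only [σ, Function.update_self, Function.update_of_ne hyx] at hxy
          exact absurd hxy.symm (hi' y hyx)
        · rfl
        · rcases eq_or_ne y k with rfl | hy
          · simp only [σ, Function.update_self, Function.update_of_ne hx] at hxy
            exact absurd hxy (hi' x hx)
          · simp only [σ, Function.update_of_ne hx, Function.update_of_ne hy] at hxy
            exact hv (by rw [hτ x hx, hτ y hy, hxy])
      let e : Equiv.Perm (Fin m) := Equiv.ofBijective σ (Finite.injective_iff_bijective.1 hinj)
      have : (fun l => b (v l)) = (Function.update dX i (dU a) : Fin m → Adap m n) ∘ e := by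
        ext1 l
        rcases eq_or_ne l k with rfl | hl
        · simp [ha, br, e, σ]
        · have : e l = τ l := by simp [e, σ, Function.update_of_ne hl]
          rw [Function.comp_apply, this, Function.update_of_ne (hi' l hl), hτ l hl, bl]
      rw [this]
      have := β.toAlternatingMap.map_perm (Function.update dX i (dU a) : Fin m → Adap m n) e
      simp only [ContinuousAlternatingMap.coe_toAlternatingMap] at this
      rw [this, h2, smul_zero]
    · push Not at hone
      obtain ⟨l, hlk, hl⟩ := hone
      obtain ⟨c, hc⟩ : ∃ c, v l = Sum.inr c := by
        rcases hvk : v l with i | c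
        · exact absurd hvk (hl i)
        · exact ⟨c, rfl⟩
      refine hβ _ {k, l} (Finset.card_pair hlk.symm) ?_
      intro j hj
      rcases Finset.mem_insert.1 hj with rfl | hj
      · simp [ha, br]
      · rw [Finset.mem_singleton.1 hj]; simp [hc, br]

theorem formCoord_sub (β γ : Adap m n [⋀^Fin m]→L[ℝ] ℝ) :
    formCoord (β - γ) = formCoord β - formCoord γ := by
  ext <;> simp [formCoord]

theorem coordForm_formCoord {β : Adap m n [⋀^Fin m]→L[ℝ] ℝ}
    (hβ : β ∈ horizontal (ContinuousLinearMap.fst ℝ (Rn m) (Rn n)) 2 m) :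
    coordForm (formCoord β) = β := by
  refine sub_eq_zero.1 (eq_zero_of_formCoord (Submodule.sub_mem _ (coordForm_mem _) hβ) ?_)
  rw [formCoord_sub, formCoord_coordForm, sub_self]

end Model


/-! ### Fibrations and adapted charts -/

section Fibration

variable {M E : Type*} [TopologicalSpace M] [TopologicalSpace E]

/-- `π : E → M` is a fibration, that is, a smooth surjective submersion, from a manifold of
dimension `m + n` onto a manifold of dimension `m`. -/
class IsFibration (m n : ℕ) [ChartedSpace (Rn m) M] [ChartedSpace (Rn (m + n)) E]
    (π : E → M) : Prop where
  surjective : Function.Surjective π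
  submersion : Manifold.IsSubmersion (𝓡 (m + n)) (𝓡 m) ∞ π

/-- Fibered coordinates `(xⁱ, uᵅ)` on an open subset of `E`, over coordinates `(xⁱ)` on an open
subset of `M`. -/
structure AdaptedChart (m n : ℕ) [ChartedSpace (Rn m) M] [ChartedSpace (Rn (m + n)) E]
    (π : E → M) where
  e : OpenPartialHomeomorph E (Adap m n)
  f : OpenPartialHomeomorph M (Rn m)
  contMDiffOn_e : ContMDiffOn (𝓡 (m + n)) 𝓘(ℝ, Adap m n) ∞ e e.source
  contMDiffOn_e_symm : ContMDiffOn 𝓘(ℝ, Adap m n) (𝓡 (m + n)) ∞ e.symm e.target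
  contMDiffOn_f : ContMDiffOn (𝓡 m) 𝓘(ℝ, Rn m) ∞ f f.source
  contMDiffOn_f_symm : ContMDiffOn 𝓘(ℝ, Rn m) (𝓡 m) ∞ f.symm f.target
  mapsTo : ∀ u ∈ e.source, π u ∈ f.source
  fst_e : ∀ u ∈ e.source, (e u).1 = f (π u)

variable {m n : ℕ} [ChartedSpace (Rn m) M] [ChartedSpace (Rn (m + n)) E] {π : E → M}

theorem IsFibration.contMDiff (h : IsFibration m n π) :
    ContMDiff (𝓡 (m + n)) (𝓡 m) ∞ π := h.submersion.contMDiff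

theorem IsFibration.mdifferentiableAt (h : IsFibration m n π) (u : E) :
    MDifferentiableAt (𝓡 (m + n)) (𝓡 m) π u := h.contMDiff.mdifferentiableAt (by simp)

theorem exists_adaptedChart [h : IsFibration m n π] (u : E) :
    ∃ c : AdaptedChart m n π, u ∈ c.e.source := by
  have hu := h.submersion.isSubmersionAt u
  obtain ⟨F, _, _, hu⟩ := hu
  have : FiniteDimensional ℝ (Rn m × F) := hu.equiv.toLinearEquiv.finiteDimensional
  have : FiniteDimensional ℝ F :=
    FiniteDimensional.of_surjective (LinearMap.snd ℝ (Rn m) F) LinearMap.snd_surjective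
  have hF : Module.finrank ℝ F = Module.finrank ℝ (Rn n) := by
    have := hu.equiv.toLinearEquiv.finrank_eq
    simp at this ⊢
    omega
  let T : Rn (m + n) ≃L[ℝ] Adap m n :=
    hu.equiv.trans ((ContinuousLinearEquiv.refl ℝ _).prodCongr (ContinuousLinearEquiv.ofFinrankEq hF))
  have hT : ∀ y, (T y).1 = (hu.equiv y).1 := fun y => rfl
  have he := hu.domChart_mem_maximalAtlas
  have hf := hu.codChart_mem_maximalAtlas
  refine ⟨⟨hu.domChart.trans T.toHomeomorph.toOpenPartialHomeomorph, hu.codChart,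
    ?_, ?_, contMDiffOn_of_mem_maximalAtlas hf, contMDiffOn_symm_of_mem_maximalAtlas hf, ?_, ?_⟩, ?_⟩
  · have := contMDiffOn_of_mem_maximalAtlas he
    refine (T.contDiff.contMDiff.comp_contMDiffOn this).mono ?_
    simp
  · have := contMDiffOn_symm_of_mem_maximalAtlas he
    refine this.comp (t := hu.domChart.target) T.symm.contDiff.contMDiff.contMDiffOn ?_
    intro y hy
    simpa using hy
  · intro v hv
    exact hu.source_subset_preimage_source (by simpa using hv)
  · intro v hv
    have hv' : v ∈ hu.domChart.source := by simpa using hv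
    have hmem : hu.domChart v ∈ (hu.domChart.extend (𝓡 (m + n))).target := by
      simpa using hu.domChart.map_source hv'
    have := hu.writtenInCharts hmem
    simp [hv'] at this
    exact this.symm
  · simpa using hu.mem_domChart_source

/-- The adapted chart chosen around `u`. -/
def adaptedAt (m n : ℕ) [ChartedSpace (Rn m) M] [ChartedSpace (Rn (m + n)) E] (π : E → M)
    [IsFibration m n π] (u : E) : AdaptedChart m n π := (exists_adaptedChart u).choose

theorem mem_adaptedAt [IsFibration m n π] (u : E) : u ∈ (adaptedAt m n π u).e.source :=
  (exists_adaptedChart u).choose_spec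

namespace AdaptedChart

variable (c c' : AdaptedChart m n π)

theorem mdiff_e : c.e.MDifferentiable (𝓡 (m + n)) 𝓘(ℝ, Adap m n) :=
  ⟨c.contMDiffOn_e.mdifferentiableOn (by simp), c.contMDiffOn_e_symm.mdifferentiableOn (by simp)⟩

theorem mdiff_f : c.f.MDifferentiable (𝓡 m) 𝓘(ℝ, Rn m) :=
  ⟨c.contMDiffOn_f.mdifferentiableOn (by simp), c.contMDiffOn_f_symm.mdifferentiableOn (by simp)⟩

/-- The components `T_uE → ℝᵐ × ℝⁿ` of the tangent vectors at `u`. -/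
def D (u : E) : TangentSpace (𝓡 (m + n)) u →L[ℝ] Adap m n :=
  mfderiv (𝓡 (m + n)) 𝓘(ℝ, Adap m n) c.e u

/-- The tangent vector at `u` with given components. -/
def Dsymm (u : E) : Adap m n →L[ℝ] TangentSpace (𝓡 (m + n)) u :=
  mfderiv 𝓘(ℝ, Adap m n) (𝓡 (m + n)) c.e.symm (c.e u)

/-- The components `T_xM → ℝᵐ` of the tangent vectors at `x`. -/
def Df (x : M) : TangentSpace (𝓡 m) x →L[ℝ] Rn m :=
  mfderiv (𝓡 m) 𝓘(ℝ, Rn m) c.f x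

/-- The tangent vector at `x` with given components. -/
def Dfsymm (x : M) : Rn m →L[ℝ] TangentSpace (𝓡 m) x :=
  mfderiv 𝓘(ℝ, Rn m) (𝓡 m) c.f.symm (c.f x)

variable {c c'}

theorem Dsymm_comp_D {u : E} (hu : u ∈ c.e.source) :
    (c.Dsymm u).comp (c.D u) = ContinuousLinearMap.id ℝ _ := c.mdiff_e.symm_comp_deriv hu

theorem Dsymm_D {u : E} (hu : u ∈ c.e.source) (v : TangentSpace (𝓡 (m + n)) u) :
    c.Dsymm u (c.D u v) = v := DFunLike.congr_fun (Dsymm_comp_D hu) v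

theorem D_comp_Dsymm {u : E} (hu : u ∈ c.e.source) :
    (c.D u).comp (c.Dsymm u) = ContinuousLinearMap.id ℝ _ := by
  have := c.mdiff_e.comp_symm_deriv (c.e.map_source hu)
  rw [c.e.left_inv hu] at this
  exact this

theorem D_Dsymm {u : E} (hu : u ∈ c.e.source) (v : Adap m n) :
    c.D u (c.Dsymm u v) = v := DFunLike.congr_fun (D_comp_Dsymm hu) v

theorem Dfsymm_Df {x : M} (hx : x ∈ c.f.source) (v : TangentSpace (𝓡 m) x) :
    c.Dfsymm x (c.Df x v) = v := DFunLike.congr_fun (c.mdiff_f.symm_comp_deriv hx) v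

theorem Df_Dfsymm {x : M} (hx : x ∈ c.f.source) (v : Rn m) :
    c.Df x (c.Dfsymm x v) = v := by
  have := c.mdiff_f.comp_symm_deriv (c.f.map_source hx)
  rw [c.f.left_inv hx] at this
  exact DFunLike.congr_fun this v

theorem fst_D [h : IsFibration m n π] {u : E} (hu : u ∈ c.e.source)
    (v : TangentSpace (𝓡 (m + n)) u) :
    (c.D u v).1 = c.Df (π u) (mfderiv (𝓡 (m + n)) (𝓡 m) π u v) := by
  have h1 : mfderiv (𝓡 (m + n)) 𝓘(ℝ, Rn m) (fun y => (c.e y).1) u =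
      mfderiv (𝓡 (m + n)) 𝓘(ℝ, Rn m) (c.f ∘ π) u := by
    apply Filter.EventuallyEq.mfderiv_eq
    filter_upwards [c.e.open_source.mem_nhds hu] with y hy using c.fst_e y hy
  have h2 : mfderiv (𝓡 (m + n)) 𝓘(ℝ, Rn m) (fun y => (c.e y).1) u =
      (ContinuousLinearMap.fst ℝ (Rn m) (Rn n)).comp (c.D u) := by
    have : MDifferentiableAt 𝓘(ℝ, Adap m n) 𝓘(ℝ, Rn m) (Prod.fst : Adap m n → Rn m) (c.e u) :=
      differentiableAt_fst.mdifferentiableAt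
    rw [show (fun y => (c.e y).1) = Prod.fst ∘ c.e from rfl,
      mfderiv_comp u this (c.mdiff_e.mdifferentiableAt hu), mfderiv_eq_fderiv, fderiv_fst]
    rfl
  have h3 : mfderiv (𝓡 (m + n)) 𝓘(ℝ, Rn m) (c.f ∘ π) u =
      (c.Df (π u)).comp (mfderiv (𝓡 (m + n)) (𝓡 m) π u) :=
    mfderiv_comp u (c.mdiff_f.mdifferentiableAt (c.mapsTo u hu)) (h.mdifferentiableAt u)
  exact DFunLike.congr_fun (h2.symm.trans (h1.trans h3)) v

theorem mfderiv_Dsymm [h : IsFibration m n π] {u : E} (hu : u ∈ c.e.source) (v : Adap m n) :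
    mfderiv (𝓡 (m + n)) (𝓡 m) π u (c.Dsymm u v) = c.Dfsymm (π u) v.1 := by
  rw [← Dfsymm_Df (c.mapsTo u hu) (mfderiv (𝓡 (m + n)) (𝓡 m) π u (c.Dsymm u v)), ← fst_D hu,
    D_Dsymm hu]

variable (c c')

/-- The change of adapted coordinates. -/
def trans : Adap m n → Adap m n := c'.e ∘ c.e.symm

theorem contDiffOn_trans : ContDiffOn ℝ ∞ (c.trans c') (c.e.symm.trans c'.e).source := by
  rw [← contMDiffOn_iff_contDiffOn]
  refine c'.contMDiffOn_e.comp (c.contMDiffOn_e_symm.mono ?_) ?_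
  · intro y hy; simp at hy; exact hy.1
  · intro y hy; simp at hy; exact hy.2

/-- The change of coordinates on the base. -/
def transf : Rn m → Rn m := c'.f ∘ c.f.symm

theorem contDiffOn_transf : ContDiffOn ℝ ∞ (c.transf c') (c.f.symm.trans c'.f).source := by
  rw [← contMDiffOn_iff_contDiffOn]
  refine c'.contMDiffOn_f.comp (c.contMDiffOn_f_symm.mono ?_) ?_
  · intro y hy; simp at hy; exact hy.1
  · intro y hy; simp at hy; exact hy.2

variable {c c'}

theorem D_comp_Dsymm' {u : E} (hu : u ∈ c.e.source) (hu' : u ∈ c'.e.source) :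
    (c'.D u).comp (c.Dsymm u) = fderiv ℝ (c.trans c') (c.e u) := by
  have h1 := mfderiv_comp (I := 𝓘(ℝ, Adap m n)) (I' := 𝓡 (m + n)) (I'' := 𝓘(ℝ, Adap m n))
    (c.e u) (g := c'.e) (f := c.e.symm)
    (c'.mdiff_e.mdifferentiableAt (by rwa [c.e.left_inv hu]))
    (c.mdiff_e.mdifferentiableAt_symm (c.e.map_source hu))
  rw [c.e.left_inv hu, mfderiv_eq_fderiv] at h1
  exact h1.symm

theorem Df_comp_Dfsymm' {x : M} (hx : x ∈ c.f.source) (hx' : x ∈ c'.f.source) :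
    (c'.Df x).comp (c.Dfsymm x) = fderiv ℝ (c.transf c') (c.f x) := by
  have h1 := mfderiv_comp (I := 𝓘(ℝ, Rn m)) (I' := 𝓡 m) (I'' := 𝓘(ℝ, Rn m))
    (c.f x) (g := c'.f) (f := c.f.symm)
    (c'.mdiff_f.mdifferentiableAt (by rwa [c.f.left_inv hx]))
    (c.mdiff_f.mdifferentiableAt_symm (c.f.map_source hx))
  rw [c.f.left_inv hx, mfderiv_eq_fderiv] at h1
  exact h1.symm

end AdaptedChart

/-! ### Bundles over `E` with natural coordinates -/

/-- The natural charts of a bundle `P → E` with fibre coordinates in `F`, one for each adapted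
chart of `E`. Here `fib c` gives the fibre coordinates of a point of `P`, and `point c u a` is the point
over `u` with fibre coordinates `a`. -/
structure NatBundle (m n : ℕ) [ChartedSpace (Rn m) M] [ChartedSpace (Rn (m + n)) E] (π : E → M)
    (P : Type*) (F : Type*) [NormedAddCommGroup F] [NormedSpace ℝ F] where
  proj : P → E
  fib : AdaptedChart m n π → P → F
  point : AdaptedChart m n π → E → F → P
  proj_point : ∀ c u a, proj (point c u a) = u
  fib_point : ∀ c u a, u ∈ c.e.source → fib c (point c u a) = a
  point_fib : ∀ c p, proj p ∈ c.e.source → point c (proj p) (fib c p) = p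
  smooth : ∀ c c' : AdaptedChart m n π,
    ContDiffOn ℝ ∞ (fun q : Adap m n × F => fib c' (point c (c.e.symm q.1) q.2))
      ((c.e.symm.trans c'.e).source ×ˢ univ)

namespace NatBundle

variable {P F : Type*} [NormedAddCommGroup F] [NormedSpace ℝ F] (B : NatBundle m n π P F)

/-- The natural chart of `P` induced by an adapted chart of `E`. -/
def chart (c : AdaptedChart m n π) : PartialEquiv P (Adap m n × F) where
  toFun p := (c.e (B.proj p), B.fib c p)
  invFun q := B.point c (c.e.symm q.1) q.2
  source := B.proj ⁻¹' c.e.source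
  target := c.e.target ×ˢ univ
  map_source' _ hp := ⟨c.e.map_source hp, trivial⟩
  map_target' q hq := by
    change B.proj _ ∈ c.e.source
    rw [B.proj_point]; exact c.e.map_target hq.1
  left_inv' p hp := by
    change B.point c (c.e.symm (c.e (B.proj p))) (B.fib c p) = p
    rw [c.e.left_inv hp, B.point_fib c p hp]
  right_inv' q hq := by
    rw [B.proj_point, c.e.right_inv hq.1, B.fib_point c _ _ (c.e.map_target hq.1)]

theorem chart_apply (c : AdaptedChart m n π) (p : P) :
    B.chart c p = (c.e (B.proj p), B.fib c p) := rfl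

theorem chart_symm_apply (c : AdaptedChart m n π) (q : Adap m n × F) :
    (B.chart c).symm q = B.point c (c.e.symm q.1) q.2 := rfl

theorem chart_source (c : AdaptedChart m n π) : (B.chart c).source = B.proj ⁻¹' c.e.source := rfl

theorem chart_target (c : AdaptedChart m n π) : (B.chart c).target = c.e.target ×ˢ univ := rfl

theorem chart_trans_source (c c' : AdaptedChart m n π) :
    ((B.chart c).symm.trans (B.chart c')).source = (c.e.symm.trans c'.e).source ×ˢ univ := by
  ext q
  simp [PartialEquiv.trans_source, chart_source, chart_target, chart_symm_apply, B.proj_point]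

theorem contDiffOn_chart_trans (c c' : AdaptedChart m n π) :
    ContDiffOn ℝ ∞ ((B.chart c).symm.trans (B.chart c'))
      ((B.chart c).symm.trans (B.chart c')).source := by
  rw [chart_trans_source]
  have h1 : ContDiffOn ℝ ∞ (fun q : Adap m n × F => c.trans c' q.1)
      ((c.e.symm.trans c'.e).source ×ˢ univ) :=
    (c.contDiffOn_trans c').comp contDiff_fst.contDiffOn (fun q hq => hq.1)
  refine (h1.prodMk (B.smooth c c')).congr fun q hq => ?_
  simp [chart_apply, chart_symm_apply, AdaptedChart.trans, B.proj_point]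

variable [IsFibration m n π]

/-- The charted space structure of `P` given by the natural charts. -/
def core : ChartedSpaceCore (Adap m n × F) P where
  atlas := range B.chart
  chartAt p := B.chart (adaptedAt m n π (B.proj p))
  mem_chart_source p := mem_adaptedAt (B.proj p)
  chart_mem_atlas p := mem_range_self _
  open_source := by
    rintro _ _ ⟨c, rfl⟩ ⟨c', rfl⟩
    rw [chart_trans_source]
    exact (c.e.symm.trans c'.e).open_source.prod isOpen_univ
  continuousOn_toFun := by
    rintro _ _ ⟨c, rfl⟩ ⟨c', rfl⟩
    exact (B.contDiffOn_chart_trans c c').continuousOn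

theorem isManifold :
    letI := B.core.toTopologicalSpace
    letI := B.core.toChartedSpace
    IsManifold 𝓘(ℝ, Adap m n × F) ∞ P := by
  let := B.core.toTopologicalSpace
  let := B.core.toChartedSpace
  refine isManifold_of_contDiffOn _ _ _ ?_
  intro e e' he he'
  change e ∈ ⋃ (e) (he : e ∈ B.core.atlas), {B.core.openPartialHomeomorph e he} at he
  change e' ∈ ⋃ (e) (he : e ∈ B.core.atlas), {B.core.openPartialHomeomorph e he} at he'
  simp only [mem_iUnion, mem_singleton_iff] at he he'
  obtain ⟨_, ⟨c, rfl⟩, rfl⟩ := he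
  obtain ⟨_, ⟨c', rfl⟩, rfl⟩ := he'
  have := B.contDiffOn_chart_trans c c'
  simp only [modelWithCornersSelf_coe, modelWithCornersSelf_coe_symm, range_id, preimage_id,
    inter_univ, Function.id_comp, Function.comp_id]
  exact this

theorem contMDiff_proj :
    letI := B.core.toTopologicalSpace
    letI := B.core.toChartedSpace
    ContMDiff 𝓘(ℝ, Adap m n × F) (𝓡 (m + n)) ∞ B.proj := by
  let := B.core.toTopologicalSpace
  let := B.core.toChartedSpace
  have := B.isManifold
  intro p
  have hp : B.proj p ∈ (adaptedAt m n π (B.proj p)).e.source := mem_adaptedAt _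
  have h1 : ContMDiffAt 𝓘(ℝ, Adap m n × F) 𝓘(ℝ, Adap m n × F) ∞
      (chartAt (Adap m n × F) p) p := contMDiffAt_of_mem_maximalAtlas
    (IsManifold.chart_mem_maximalAtlas p) (mem_chart_source _ p)
  have h2 : ContMDiffAt 𝓘(ℝ, Adap m n) (𝓡 (m + n)) ∞
      (adaptedAt m n π (B.proj p)).e.symm ((adaptedAt m n π (B.proj p)).e (B.proj p)) :=
    (adaptedAt m n π (B.proj p)).contMDiffOn_e_symm.contMDiffAt
      ((adaptedAt m n π (B.proj p)).e.open_target.mem_nhds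
        ((adaptedAt m n π (B.proj p)).e.map_source hp))
  have h3 : ContMDiffAt 𝓘(ℝ, Adap m n × F) 𝓘(ℝ, Adap m n) ∞
      (fun p' => (chartAt (Adap m n × F) p p').1) p := by
    exact (contDiff_fst.contMDiff.contMDiffAt).comp p h1
  have h4 := ContMDiffAt.comp p (g := (adaptedAt m n π (B.proj p)).e.symm) h2 h3
  refine h4.congr_of_eventuallyEq ?_
  filter_upwards [(chartAt (Adap m n × F) p).open_source.mem_nhds (mem_chart_source _ p)]
    with p' hp'
  exact ((adaptedAt m n π (B.proj p)).e.left_inv hp').symm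

end NatBundle

end Fibration


/-! ### The first jet bundle -/

section Jet

/-- The first jet bundle `J¹π` of `π : E → M`: its points over `u : E` are the linear maps
`z : T_{π(u)}M → T_uE` with `T_uπ ∘ z = id`, that is, the tangent maps of local sections. -/
structure Jet (X Y : Type*) [NormedAddCommGroup X] [NormedSpace ℝ X] [NormedAddCommGroup Y]
    [NormedSpace ℝ Y] {M E : Type*} [TopologicalSpace M] [ChartedSpace X M] [TopologicalSpace E]
    [ChartedSpace Y E] (π : E → M) where
  pt : E
  map : TangentSpace 𝓘(ℝ, X) (π pt) →L[ℝ] TangentSpace 𝓘(ℝ, Y) pt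
  isSection : (mfderiv 𝓘(ℝ, Y) 𝓘(ℝ, X) π pt).comp map = ContinuousLinearMap.id ℝ _

variable {M E : Type*} [TopologicalSpace M] [TopologicalSpace E]

/-- The first jet bundle of a fibration. -/
abbrev Jet1 (m n : ℕ) [ChartedSpace (Rn m) M] [ChartedSpace (Rn (m + n)) E] (π : E → M) : Type _ :=
  Jet (Rn m) (Rn (m + n)) π

variable {m n : ℕ} [ChartedSpace (Rn m) M] [ChartedSpace (Rn (m + n)) E] {π : E → M}

namespace Jet1

/-- The coordinates `uᵅᵢ` of a jet, as a linear map `ℝᵐ → ℝⁿ`. -/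
def fib (c : AdaptedChart m n π) (z : Jet1 m n π) : Rn m →L[ℝ] Rn n :=
  (ContinuousLinearMap.snd ℝ (Rn m) (Rn n)).comp
    (((c.D z.pt).comp z.map).comp (c.Dfsymm (π z.pt)))

variable [h : IsFibration m n π]

/-- The jet at `u` with coordinates `a`. -/
def ofCoord (c : AdaptedChart m n π) (u : E) (hu : u ∈ c.e.source) (a : Rn m →L[ℝ] Rn n) :
    Jet1 m n π where
  pt := u
  map := ((c.Dsymm u).comp ((ContinuousLinearMap.id ℝ (Rn m)).prod a)).comp (c.Df (π u))
  isSection := by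
    ext1 v
    change mfderiv (𝓡 (m + n)) (𝓡 m) π u (c.Dsymm u (c.Df (π u) v, a (c.Df (π u) v))) = v
    rw [AdaptedChart.mfderiv_Dsymm hu, AdaptedChart.Dfsymm_Df (c.mapsTo u hu)]

/-- The jet at `u` with coordinates `a`, with a default value outside the domain of the chart. -/
def point (c : AdaptedChart m n π) (u : E) (a : Rn m →L[ℝ] Rn n) : Jet1 m n π := by
  classical
  exact if hu : u ∈ c.e.source then ofCoord c u hu a
    else ofCoord (adaptedAt m n π u) u (mem_adaptedAt u) 0

theorem point_of_mem {c : AdaptedChart m n π} {u : E} (hu : u ∈ c.e.source) (a : Rn m →L[ℝ] Rn n) :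
    point c u a = ofCoord c u hu a := by simp [point, hu]

/-- The natural charts `(xⁱ, uᵅ, uᵅᵢ)` of `J¹π`. -/
def natBundle (m n : ℕ) [ChartedSpace (Rn m) M] [ChartedSpace (Rn (m + n)) E] (π : E → M)
    [h : IsFibration m n π] : NatBundle m n π (Jet1 m n π) (Rn m →L[ℝ] Rn n) where
  proj := Jet.pt
  fib := fib
  point := point
  proj_point c u a := by
    unfold point; split_ifs <;> rfl
  fib_point c u a hu := by
    rw [point_of_mem hu]
    ext1 v
    change (c.D u (c.Dsymm u (c.Df (π u) (c.Dfsymm (π u) v), a (c.Df (π u) (c.Dfsymm (π u) v))))).2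
      = a v
    rw [AdaptedChart.D_Dsymm hu, AdaptedChart.Df_Dfsymm (c.mapsTo u hu)]
  point_fib c z hz := by
    rw [point_of_mem hz]
    obtain ⟨u, z, hzs⟩ := z
    simp only [ofCoord, Jet.mk.injEq, true_and]
    ext1 v
    change c.Dsymm u (c.Df (π u) v, (c.D u (z (c.Dfsymm (π u) (c.Df (π u) v)))).2) = z v
    rw [AdaptedChart.Dfsymm_Df (c.mapsTo u hz)]
    have h1 : (c.D u (z v)).1 = c.Df (π u) v := by
      rw [AdaptedChart.fst_D hz]
      exact congrArg _ (DFunLike.congr_fun hzs v)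
    rw [← h1, AdaptedChart.Dsymm_D hz]
  smooth c c' := by
    have hopen := (c.e.symm.trans c'.e).open_source
    have hT : ContDiffOn ℝ ∞ (fun q : Adap m n × (Rn m →L[ℝ] Rn n) => fderiv ℝ (c.trans c') q.1)
        ((c.e.symm.trans c'.e).source ×ˢ univ) :=
      ((c.contDiffOn_trans c').fderiv_of_isOpen hopen (by simp)).comp contDiff_fst.contDiffOn
        (fun q hq => hq.1)
    have hx : ContDiffOn ℝ ∞ (fun q : Adap m n × (Rn m →L[ℝ] Rn n) => (c.trans c' q.1).1)
        ((c.e.symm.trans c'.e).source ×ˢ univ) :=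
      contDiff_fst.comp_contDiffOn
        ((c.contDiffOn_trans c').comp contDiff_fst.contDiffOn (fun q hq => hq.1))
    have hS : ContDiffOn ℝ ∞
        (fun q : Adap m n × (Rn m →L[ℝ] Rn n) => fderiv ℝ (c'.transf c) (c.trans c' q.1).1)
        ((c.e.symm.trans c'.e).source ×ˢ univ) := by
      refine ((c'.contDiffOn_transf c).fderiv_of_isOpen (c'.f.symm.trans c.f).open_source
        (by simp)).comp hx ?_
      rintro q ⟨hq, -⟩
      simp only [OpenPartialHomeomorph.trans_source, OpenPartialHomeomorph.symm_source,
        mem_inter_iff, mem_preimage] at hq ⊢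
      have h1 : (c.trans c' q.1).1 = c'.f (π (c.e.symm q.1)) := c'.fst_e _ hq.2
      rw [h1, c'.f.left_inv (c'.mapsTo _ hq.2)]
      exact ⟨c'.f.map_source (c'.mapsTo _ hq.2), c.mapsTo _ (c.e.map_target hq.1)⟩
    have ha : ContDiff ℝ ∞ (fun q : Adap m n × (Rn m →L[ℝ] Rn n) =>
        ContinuousLinearMap.inl ℝ (Rn m) (Rn n) +
          (ContinuousLinearMap.inr ℝ (Rn m) (Rn n)).comp q.2) :=
      contDiff_const.add (contDiff_const.clm_comp contDiff_snd)
    refine (contDiffOn_const (c := ContinuousLinearMap.snd ℝ (Rn m) (Rn n))).clm_comp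
      ((hT.clm_comp ha.contDiffOn).clm_comp hS) |>.congr ?_
    rintro ⟨y, a⟩ ⟨hy, -⟩
    simp only [OpenPartialHomeomorph.trans_source, OpenPartialHomeomorph.symm_source,
      mem_inter_iff, mem_preimage] at hy
    have hu := c.e.map_target hy.1
    rw [point_of_mem hu]
    have e1 := AdaptedChart.D_comp_Dsymm' hu hy.2
    have e2 := AdaptedChart.Df_comp_Dfsymm' (c := c') (c' := c) (c'.mapsTo _ hy.2) (c.mapsTo _ hu)
    rw [c.e.right_inv hy.1] at e1
    rw [← c'.fst_e _ hy.2] at e2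
    change _ = (ContinuousLinearMap.snd ℝ (Rn m) (Rn n)).comp (((fderiv ℝ (c.trans c') y).comp _).comp
      (fderiv ℝ (c'.transf c) (c'.e (c.e.symm y)).1))
    rw [← e1, ← e2]
    ext1 v
    change (c'.D _ (c.Dsymm _ (c.Df _ (c'.Dfsymm _ v), a (c.Df _ (c'.Dfsymm _ v))))).2 =
      (c'.D _ (c.Dsymm _ ((c.Df _ (c'.Dfsymm _ v), 0) + (0, a (c.Df _ (c'.Dfsymm _ v)))))).2
    simp only [Prod.mk_add_mk, add_zero, zero_add]
    rfl

end Jet1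

variable [IsFibration m n π]

instance : TopologicalSpace (Jet1 m n π) := (Jet1.natBundle m n π).core.toTopologicalSpace

instance : ChartedSpace (Adap m n × (Rn m →L[ℝ] Rn n)) (Jet1 m n π) :=
  (Jet1.natBundle m n π).core.toChartedSpace

instance : IsManifold 𝓘(ℝ, Adap m n × (Rn m →L[ℝ] Rn n)) ∞ (Jet1 m n π) :=
  (Jet1.natBundle m n π).isManifold

end Jet

/-! ### The multimomentum bundles -/

section Momentum

variable {M E : Type*} [TopologicalSpace M] [TopologicalSpace E]

/-- The fibre over `u` of the bundle `Λᵏᵣ E` of `r`-horizontal `k`-forms. -/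
abbrev horizontalForms {X Y : Type*} [NormedAddCommGroup X] [NormedSpace ℝ X]
    [NormedAddCommGroup Y] [NormedSpace ℝ Y] [ChartedSpace X M] [ChartedSpace Y E] (π : E → M)
    (r k : ℕ) (u : E) : Submodule ℝ (TangentSpace 𝓘(ℝ, Y) u [⋀^Fin k]→L[ℝ] ℝ) :=
  horizontal (mfderiv 𝓘(ℝ, Y) 𝓘(ℝ, X) π u) r k

/-- The extended multimomentum bundle `𝓜π = Λᵐ₂ E`. -/
structure Mom (m n : ℕ) [ChartedSpace (Rn m) M] [ChartedSpace (Rn (m + n)) E] (π : E → M) where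
  pt : E
  form : horizontalForms (X := Rn m) (Y := Rn (m + n)) π 2 m pt

/-- The fibre over `u` of the reduced multimomentum bundle `𝓜°π = Λᵐ₂ E / Λᵐ₁ E`. -/
abbrev RedMomFiber (m n : ℕ) [ChartedSpace (Rn m) M] [ChartedSpace (Rn (m + n)) E] (π : E → M)
    (u : E) : Type :=
  RedForms (mfderiv (𝓡 (m + n)) (𝓡 m) π u) m

/-- The reduced multimomentum bundle `𝓜°π = Λᵐ₂ E / Λᵐ₁ E`. -/
structure RedMom (m n : ℕ) [ChartedSpace (Rn m) M] [ChartedSpace (Rn (m + n)) E]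
    (π : E → M) where
  pt : E
  cls : RedMomFiber m n π pt

variable {m n : ℕ} [ChartedSpace (Rn m) M] [ChartedSpace (Rn (m + n)) E] {π : E → M}

/-- The projection `μ : 𝓜π → 𝓜°π`. -/
def Mom.toRed (β : Mom m n π) : RedMom m n π := ⟨β.pt, RedForms.mk β.form⟩

namespace Mom

/-- The coordinates `(p, pⁱ_α)` of an `m`-form at `u`. -/
def coordAt (c : AdaptedChart m n π) (u : E)
    (β : TangentSpace (𝓡 (m + n)) u [⋀^Fin m]→L[ℝ] ℝ) : ℝ × (Fin m → Fin n → ℝ) :=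
  formCoord (β.compContinuousLinearMap (c.Dsymm u))

/-- The `m`-form at `u` with coordinates `(p, pⁱ_α)`. -/
def formAt (c : AdaptedChart m n π) (u : E) (q : ℝ × (Fin m → Fin n → ℝ)) :
    TangentSpace (𝓡 (m + n)) u [⋀^Fin m]→L[ℝ] ℝ :=
  (coordForm q).compContinuousLinearMap (c.D u)

theorem compDsymm_mem [IsFibration m n π] {c : AdaptedChart m n π} {u : E} (hu : u ∈ c.e.source)
    {r k : ℕ} {β : TangentSpace (𝓡 (m + n)) u [⋀^Fin k]→L[ℝ] ℝ}
    (hβ : β ∈ horizontalForms (X := Rn m) (Y := Rn (m + n)) π r k u) :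
    β.compContinuousLinearMap (c.Dsymm u) ∈
      horizontal (ContinuousLinearMap.fst ℝ (Rn m) (Rn n)) r k := by
  rw [mem_horizontal]
  intro v s hs hv
  refine hβ _ s hs fun i hi => ?_
  have h := AdaptedChart.mfderiv_Dsymm hu (v i)
  have hvi : (v i).1 = 0 := hv i hi
  rw [hvi, map_zero] at h
  exact h

theorem formAt_mem [IsFibration m n π] {c : AdaptedChart m n π} {u : E} (hu : u ∈ c.e.source)
    (q : ℝ × (Fin m → Fin n → ℝ)) :
    formAt c u q ∈ horizontalForms (X := Rn m) (Y := Rn (m + n)) π 2 m u := by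
  intro v s hs hv
  refine coordForm_mem q _ s hs fun i hi => ?_
  have h := AdaptedChart.fst_D hu (v i)
  have hvi : mfderiv (𝓡 (m + n)) (𝓡 m) π u (v i) = 0 := hv i hi
  rw [hvi, map_zero] at h
  exact h

theorem coordAt_formAt {c : AdaptedChart m n π} {u : E} (hu : u ∈ c.e.source)
    (q : ℝ × (Fin m → Fin n → ℝ)) : coordAt c u (formAt c u q) = q := by
  have : (formAt c u q).compContinuousLinearMap (c.Dsymm u) = coordForm q := by
    ext v
    change coordForm q (fun i => c.D u (c.Dsymm u (v i))) = coordForm q v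
    congr 1
    ext1 i
    exact AdaptedChart.D_Dsymm hu (v i)
  rw [coordAt, this, formCoord_coordForm]

theorem formAt_coordAt [IsFibration m n π] {c : AdaptedChart m n π} {u : E} (hu : u ∈ c.e.source)
    {β : TangentSpace (𝓡 (m + n)) u [⋀^Fin m]→L[ℝ] ℝ}
    (hβ : β ∈ horizontalForms (X := Rn m) (Y := Rn (m + n)) π 2 m u) :
    formAt c u (coordAt c u β) = β := by
  rw [formAt, coordAt, coordForm_formCoord (compDsymm_mem hu hβ)]
  ext v
  change β (fun i => c.Dsymm u (c.D u (v i))) = β v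
  congr 1
  ext1 i
  exact AdaptedChart.Dsymm_D hu (v i)

/-- The form at `u` with coordinates `q`, and zero outside the domain of the chart. -/
def point [IsFibration m n π] (c : AdaptedChart m n π) (u : E) (q : ℝ × (Fin m → Fin n → ℝ)) :
    Mom m n π := by
  classical
  exact if hu : u ∈ c.e.source then ⟨u, ⟨formAt c u q, formAt_mem hu q⟩⟩ else ⟨u, 0⟩

theorem point_of_mem [IsFibration m n π] {c : AdaptedChart m n π} {u : E} (hu : u ∈ c.e.source)
    (q : ℝ × (Fin m → Fin n → ℝ)) : point c u q = ⟨u, ⟨formAt c u q, formAt_mem hu q⟩⟩ := by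
  simp [point, hu]

theorem contDiff_stdVol (m : ℕ) : ContDiff ℝ ∞ (fun v : Fin m → Rn m => stdVol m v) :=
  (stdVol m).toContinuousMultilinearMap.contDiff

theorem contDiff_coordForm_apply :
    ContDiff ℝ ∞ (fun q : (ℝ × (Fin m → Fin n → ℝ)) × (Fin m → Adap m n) =>
      coordForm q.1 q.2) := by
  simp only [coordForm_apply]
  refine ContDiff.add ?_ (ContDiff.sum fun k _ => (contDiff_stdVol m).comp ?_)
  · refine (contDiff_fst.comp contDiff_fst).mul ((contDiff_stdVol m).comp ?_)
    fun_prop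
  · rw [contDiff_pi]
    intro l
    rcases eq_or_ne l k with rfl | hl
    · simp only [Function.update_self, momEndo_apply]
      fun_prop
    · simp only [Function.update_of_ne hl]
      fun_prop

theorem contDiff_formCoord_comp :
    ContDiff ℝ ∞ (fun q : (ℝ × (Fin m → Fin n → ℝ)) × (Adap m n →L[ℝ] Adap m n) =>
      formCoord ((coordForm q.1).compContinuousLinearMap q.2)) := by
  refine ContDiff.prodMk ?_ (contDiff_pi.2 fun i => contDiff_pi.2 fun a => ?_)
  · exact contDiff_coordForm_apply.comp (contDiff_fst.prodMk (contDiff_pi.2 fun l =>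
      contDiff_snd.clm_apply contDiff_const))
  · exact contDiff_coordForm_apply.comp (contDiff_fst.prodMk (contDiff_pi.2 fun l =>
      contDiff_snd.clm_apply contDiff_const))

theorem contDiffOn_coordAt_formAt (c c' : AdaptedChart m n π) :
    ContDiffOn ℝ ∞ (fun q : Adap m n × (ℝ × (Fin m → Fin n → ℝ)) =>
      coordAt c' (c.e.symm q.1) (formAt c (c.e.symm q.1) q.2))
      ((c.e.symm.trans c'.e).source ×ˢ univ) := by
  have hS : ContDiffOn ℝ ∞ (fun q : Adap m n × (ℝ × (Fin m → Fin n → ℝ)) =>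
      fderiv ℝ (c'.trans c) (c.trans c' q.1)) ((c.e.symm.trans c'.e).source ×ˢ univ) := by
    refine ((c'.contDiffOn_trans c).fderiv_of_isOpen (c'.e.symm.trans c.e).open_source
      (by simp)).comp
        ((c.contDiffOn_trans c').comp contDiff_fst.contDiffOn (fun q hq => hq.1)) ?_
    rintro q ⟨hq, -⟩
    simp only [OpenPartialHomeomorph.trans_source, OpenPartialHomeomorph.symm_source,
      mem_inter_iff, mem_preimage] at hq ⊢
    have h1 : c.trans c' q.1 = c'.e (c.e.symm q.1) := rfl
    rw [h1, c'.e.left_inv hq.2]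
    exact ⟨c'.e.map_source hq.2, c.e.map_target hq.1⟩
  refine (contDiff_formCoord_comp.comp_contDiffOn (contDiff_snd.contDiffOn.prodMk hS)).congr ?_
  rintro ⟨y, q⟩ ⟨hy, -⟩
  simp only [OpenPartialHomeomorph.trans_source, OpenPartialHomeomorph.symm_source,
    mem_inter_iff, mem_preimage] at hy
  have e1 := AdaptedChart.D_comp_Dsymm' (c := c') (c' := c) hy.2 (c.e.map_target hy.1)
  change _ = formCoord ((coordForm q).compContinuousLinearMap
    (fderiv ℝ (c'.trans c) (c'.e (c.e.symm y))))
  rw [← e1]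
  rfl

/-- The natural charts `(xⁱ, uᵅ, p, pⁱ_α)` of `𝓜π`, such that
`ω = p dᵐx + pⁱ_α duᵅ ∧ dᵐ⁻¹xᵢ`. -/
def natBundle (m n : ℕ) [ChartedSpace (Rn m) M] [ChartedSpace (Rn (m + n)) E] (π : E → M)
    [IsFibration m n π] : NatBundle m n π (Mom m n π) (ℝ × (Fin m → Fin n → ℝ)) where
  proj := Mom.pt
  fib c β := coordAt c β.pt β.form
  point := point
  proj_point c u a := by
    unfold point; split_ifs <;> rfl
  fib_point c u q hu := by
    rw [point_of_mem hu]
    exact coordAt_formAt hu q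
  point_fib c β hβ := by
    rw [point_of_mem hβ]
    obtain ⟨u, β, hβ'⟩ := β
    simp only [Mom.mk.injEq, heq_eq_eq, true_and, Subtype.mk.injEq]
    exact formAt_coordAt hβ hβ'
  smooth c c' := by
    refine (contDiffOn_coordAt_formAt c c').congr ?_
    rintro ⟨y, q⟩ ⟨hy, -⟩
    simp only [OpenPartialHomeomorph.trans_source, OpenPartialHomeomorph.symm_source,
      mem_inter_iff, mem_preimage] at hy
    have := point_of_mem (c.e.map_target hy.1) q
    change coordAt c' (point c (c.e.symm y) q).pt (point c (c.e.symm y) q).form = _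
    rw [this]

end Mom

namespace RedMom

/-- The coordinates `pⁱ_α` of a class of forms. -/
def fib (c : AdaptedChart m n π) (β : RedMom m n π) : Fin m → Fin n → ℝ :=
  (Mom.coordAt c β.pt β.cls.out.1).2

theorem coordAt_snd_eq [IsFibration m n π] {c : AdaptedChart m n π} {u : E} (hu : u ∈ c.e.source)
    {β γ : horizontalForms (X := Rn m) (Y := Rn (m + n)) π 2 m u} :
    (RedForms.mk β : RedMomFiber m n π u) = RedForms.mk γ ↔
      (Mom.coordAt c u β).2 = (Mom.coordAt c u γ).2 := by
  rw [RedForms.mk_eq]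
  constructor
  · intro h
    have h := Mom.compDsymm_mem hu h
    funext i a
    have h2 := h (Function.update dX i (dU a)) {i} (by simp) (by simp)
    have : (β.1 - γ.1) (fun l => c.Dsymm u (Function.update dX i (dU a) l)) = 0 := h2
    rw [ContinuousAlternatingMap.sub_apply, sub_eq_zero] at this
    exact this
  · intro h v s hs hv
    obtain ⟨i, rfl⟩ := Finset.card_eq_one.1 hs
    have hvi : mfderiv (𝓡 (m + n)) (𝓡 m) π u (v i) = 0 := hv i (by simp)
    have e1 : β.1 - γ.1 = Mom.formAt c u (Mom.coordAt c u (β.1 - γ.1)) :=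
      (Mom.formAt_coordAt hu (Submodule.sub_mem _ β.2 γ.2)).symm
    have e2 : (Mom.coordAt c u (β.1 - γ.1)).2 = 0 := by
      have : Mom.coordAt c u (β.1 - γ.1) = Mom.coordAt c u β.1 - Mom.coordAt c u γ.1 :=
        formCoord_sub (β.1.compContinuousLinearMap (c.Dsymm u))
          (γ.1.compContinuousLinearMap (c.Dsymm u))
      rw [this, Prod.snd_sub, h, sub_self]
    rw [e1]
    change coordForm _ (fun i => c.D u (v i)) = 0
    have hz : (c.D u (v i)).1 = 0 := by rw [AdaptedChart.fst_D hu, hvi, map_zero]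
    rw [coordForm_apply, (stdVol m).map_coord_zero i hz, mul_zero, zero_add, e2]
    refine Finset.sum_eq_zero fun k _ => (stdVol m).map_coord_zero k ?_
    simp [momEndo_apply]

/-- The class at `u` with coordinates `P`. -/
def point [IsFibration m n π] (c : AdaptedChart m n π) (u : E) (P : Fin m → Fin n → ℝ) :
    RedMom m n π := (Mom.point c u (0, P)).toRed

theorem fib_toRed [IsFibration m n π] {c : AdaptedChart m n π} {β : Mom m n π}
    (hβ : β.pt ∈ c.e.source) : fib c β.toRed = (Mom.coordAt c β.pt β.form).2 :=
  (coordAt_snd_eq hβ).1 (RedForms.mk_out _)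

/-- The natural charts `(xⁱ, uᵅ, pⁱ_α)` of `𝓜°π`. -/
def natBundle (m n : ℕ) [ChartedSpace (Rn m) M] [ChartedSpace (Rn (m + n)) E] (π : E → M)
    [IsFibration m n π] : NatBundle m n π (RedMom m n π) (Fin m → Fin n → ℝ) where
  proj := RedMom.pt
  fib := fib
  point := point
  proj_point c u P := by
    change (Mom.point c u (0, P)).pt = u
    unfold Mom.point; split_ifs <;> rfl
  fib_point c u P hu := by
    rw [point, Mom.point_of_mem hu, fib_toRed hu]
    exact congrArg Prod.snd (Mom.coordAt_formAt hu (0, P))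
  point_fib c β hβ := by
    rw [point, Mom.point_of_mem hβ]
    obtain ⟨u, β⟩ := β
    refine congrArg (RedMom.mk u) ?_
    conv_rhs => rw [← RedForms.mk_out β]
    refine (coordAt_snd_eq hβ).2 ?_
    have := congrArg Prod.snd (Mom.coordAt_formAt hβ (0, (Mom.coordAt c u β.out.1).2))
    exact this
  smooth c c' := by
    have h : ContDiff ℝ ∞ (fun q : Adap m n × (Fin m → Fin n → ℝ) =>
      ((q.1, ((0 : ℝ), q.2)) : Adap m n × (ℝ × (Fin m → Fin n → ℝ)))) := by fun_prop
    refine (contDiff_snd.comp_contDiffOn ((Mom.contDiffOn_coordAt_formAt c c').comp h.contDiffOn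
      (fun q hq => ⟨hq.1, trivial⟩))).congr ?_
    rintro ⟨y, P⟩ ⟨hy, -⟩
    simp only [OpenPartialHomeomorph.trans_source, OpenPartialHomeomorph.symm_source,
      mem_inter_iff, mem_preimage] at hy
    change fib c' (Mom.point c (c.e.symm y) (0, P)).toRed = _
    rw [Mom.point_of_mem (c.e.map_target hy.1) (0, P), fib_toRed hy.2]
    rfl

end RedMom

variable [IsFibration m n π]

instance : TopologicalSpace (Mom m n π) := (Mom.natBundle m n π).core.toTopologicalSpace

/-- The model space of `𝓜π`. -/
abbrev MomModel (m n : ℕ) : Type := Adap m n × (ℝ × (Fin m → Fin n → ℝ))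

instance : ChartedSpace (MomModel m n) (Mom m n π) := (Mom.natBundle m n π).core.toChartedSpace

instance : IsManifold 𝓘(ℝ, MomModel m n) ∞ (Mom m n π) := (Mom.natBundle m n π).isManifold

instance : TopologicalSpace (RedMom m n π) := (RedMom.natBundle m n π).core.toTopologicalSpace

instance : ChartedSpace (Adap m n × (Fin m → Fin n → ℝ)) (RedMom m n π) :=
  (RedMom.natBundle m n π).core.toChartedSpace

instance : IsManifold 𝓘(ℝ, Adap m n × (Fin m → Fin n → ℝ)) ∞ (RedMom m n π) :=
  (RedMom.natBundle m n π).isManifold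

end Momentum


/-! ### Differential forms on manifolds -/

section Forms

variable {Y P : Type*} [NormedAddCommGroup Y] [NormedSpace ℝ Y] [TopologicalSpace P]
  [ChartedSpace Y P] {k : ℕ}

/-- The total space of the bundle `ΛᵏP` of `k`-forms. -/
abbrev FormBundle (Y : Type*) [NormedAddCommGroup Y] [NormedSpace ℝ Y] (P : Type*)
    [TopologicalSpace P] [ChartedSpace Y P] (k : ℕ) : Type _ :=
  Σ p : P, TangentSpace 𝓘(ℝ, Y) p [⋀^Fin k]→L[ℝ] ℝ

/-- The local expression of a differential form in a chart, that is, its pullback under the inverse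
of the chart. -/
def formInChart (c : OpenPartialHomeomorph P Y)
    (β : ∀ p : P, TangentSpace 𝓘(ℝ, Y) p [⋀^Fin k]→L[ℝ] ℝ) (y : Y) : Y [⋀^Fin k]→L[ℝ] ℝ :=
  (β (c.symm y)).compContinuousLinearMap (mfderiv 𝓘(ℝ, Y) 𝓘(ℝ, Y) c.symm y)

/-- The exterior derivative of a differential form on a manifold, at a point. The tangent space at `p`
is identified with the model space by means of the chart at `p`. -/
def extD (β : ∀ p : P, TangentSpace 𝓘(ℝ, Y) p [⋀^Fin k]→L[ℝ] ℝ) (p : P) :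
    TangentSpace 𝓘(ℝ, Y) p [⋀^Fin (k + 1)]→L[ℝ] ℝ :=
  (extDeriv (formInChart (chartAt Y p) β) (chartAt Y p p) : Y [⋀^Fin (k + 1)]→L[ℝ] ℝ)

end Forms

/-! ### Lagrangian and Hamiltonian densities -/

section Dynamics

variable {M E : Type*} [TopologicalSpace M] [TopologicalSpace E]

/-- `η` is a smooth nowhere vanishing form of top degree. -/
structure IsVolumeForm {m : ℕ} [ChartedSpace (Rn m) M]
    (η : ∀ x : M, TangentSpace (𝓡 m) x [⋀^Fin m]→L[ℝ] ℝ) : Prop where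
  smooth : ∀ x : M, ContDiffOn ℝ ∞ (formInChart (chartAt (Rn m) x) η) (chartAt (Rn m) x).target
  ne_zero : ∀ x : M, η x ≠ 0

variable {m n : ℕ} [ChartedSpace (Rn m) M] [ChartedSpace (Rn (m + n)) E] {π : E → M}

/-- The model space of `J¹π`. -/
abbrev JetModel (m n : ℕ) : Type := Adap m n × (Rn m →L[ℝ] Rn n)

/-- The linear map of a jet at `u`, considered as a map into `T_uE`. -/
def Jet.mapAt {X Y : Type*} [NormedAddCommGroup X] [NormedSpace ℝ X] [NormedAddCommGroup Y]
    [NormedSpace ℝ Y] [ChartedSpace X M] [ChartedSpace Y E] (z : Jet X Y π) {u : E}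
    (h : z.pt = u) : TangentSpace 𝓘(ℝ, X) (π u) →L[ℝ] TangentSpace 𝓘(ℝ, Y) u :=
  h ▸ z.map

theorem Jet.mapAt_rfl {X Y : Type*} [NormedAddCommGroup X] [NormedSpace ℝ X]
    [NormedAddCommGroup Y] [NormedSpace ℝ Y] [ChartedSpace X M] [ChartedSpace Y E]
    (z : Jet X Y π) : z.mapAt rfl = z.map := rfl

/-- The pullback `z^* ω = φ_x^* ω` of `ω` under a jet `z = j¹ₓφ` at the same point; this is
`⟨ω, z⟩ η`. -/
def Mom.pullback (β : Mom m n π) (z : Jet1 m n π) (h : z.pt = β.pt) :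
    TangentSpace (𝓡 m) (π β.pt) [⋀^Fin m]→L[ℝ] ℝ :=
  β.form.1.compContinuousLinearMap (z.mapAt h)

variable [IsFibration m n π]

/-- The Lagrangian density `𝓛 = L η`. -/
def lagDensity (η : ∀ x : M, TangentSpace (𝓡 m) x [⋀^Fin m]→L[ℝ] ℝ) (L : Jet1 m n π → ℝ)
    (z : Jet1 m n π) : TangentSpace (𝓡 m) (π z.pt) [⋀^Fin m]→L[ℝ] ℝ :=
  L z • η (π z.pt)

/-- The semibasic `m`-form on `J¹π` given by the Lagrangian density. -/
def lagForm (η : ∀ x : M, TangentSpace (𝓡 m) x [⋀^Fin m]→L[ℝ] ℝ) (L : Jet1 m n π → ℝ)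
    (z : Jet1 m n π) : TangentSpace 𝓘(ℝ, JetModel m n) z [⋀^Fin m]→L[ℝ] ℝ :=
  (lagDensity η L z).compContinuousLinearMap
    (mfderiv 𝓘(ℝ, JetModel m n) (𝓡 m) (fun z : Jet1 m n π => π z.pt) z)

/-- The section `d𝓛` of `Λᵐ⁺¹ J¹π`. -/
def dLag (η : ∀ x : M, TangentSpace (𝓡 m) x [⋀^Fin m]→L[ℝ] ℝ) (L : Jet1 m n π → ℝ)
    (z : Jet1 m n π) : FormBundle (JetModel m n) (Jet1 m n π) (m + 1) :=
  ⟨z, extD (lagForm η L) z⟩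

/-- The contact form `θ_z = id - z ∘ Tπ`, that is, `θᵅ ⊗ ∂/∂uᵅ` with `θᵅ = duᵅ - uᵅⱼ dxʲ`. -/
def contact (z : Jet1 m n π) : TangentSpace (𝓡 (m + n)) z.pt →L[ℝ] TangentSpace (𝓡 (m + n)) z.pt :=
  ContinuousLinearMap.id ℝ _ - z.map.comp (mfderiv (𝓡 (m + n)) (𝓡 m) π z.pt)

/-- The differential of `L` along the vertical directions: `vertDeriv L z i` sends the vector
`bᵅ ∂/∂uᵅ` to `bᵅ ∂L/∂uᵅᵢ`. -/
def vertDeriv (L : Jet1 m n π → ℝ) (z : Jet1 m n π) (i : Fin m) : Rn n →L[ℝ] ℝ :=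
  (mfderiv 𝓘(ℝ, JetModel m n) 𝓘(ℝ, ℝ) L z : JetModel m n →L[ℝ] ℝ).comp
    ((ContinuousLinearMap.inr ℝ (Adap m n) (Rn m →L[ℝ] Rn n)).comp
      (ContinuousLinearMap.smulRightL ℝ (Rn m) (Rn n) (EuclideanSpace.proj i)))

/-- The contraction of `dL` with the vertical endomorphism `S = θᵅ ⊗ ∂/∂xⁱ ⊗ ∂/∂uᵅᵢ`, that is,
`∂L/∂uᵅᵢ θᵅ ⊗ ∂/∂xⁱ`. -/
def vertEndo (L : Jet1 m n π → ℝ) (z : Jet1 m n π) :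
    TangentSpace (𝓡 (m + n)) z.pt →L[ℝ] TangentSpace (𝓡 m) (π z.pt) :=
  ∑ i, ((vertDeriv L z i).comp ((ContinuousLinearMap.snd ℝ (Rn m) (Rn n)).comp
    (((adaptedAt m n π z.pt).D z.pt).comp (contact z)))).smulRight
      ((adaptedAt m n π z.pt).Dfsymm (π z.pt) (stdBasis i))

/-- The `m`-form on `T_uE` whose pullback to `T_zJ¹π` is the Poincaré-Cartan form
`Θ_𝓛 = L η + ⟨S_η, dL⟩ = L η + ∂L/∂uᵅᵢ θᵅ ∧ i(∂/∂xⁱ) η`. -/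
def legForm (η : ∀ x : M, TangentSpace (𝓡 m) x [⋀^Fin m]→L[ℝ] ℝ) (L : Jet1 m n π → ℝ)
    (z : Jet1 m n π) : TangentSpace (𝓡 (m + n)) z.pt [⋀^Fin m]→L[ℝ] ℝ :=
  L z • (η (π z.pt)).compContinuousLinearMap (mfderiv (𝓡 (m + n)) (𝓡 m) π z.pt) +
    derivAction (z.map.comp (vertEndo L z))
      ((η (π z.pt)).compContinuousLinearMap (mfderiv (𝓡 (m + n)) (𝓡 m) π z.pt))

theorem legForm_mem (η : ∀ x : M, TangentSpace (𝓡 m) x [⋀^Fin m]→L[ℝ] ℝ) (L : Jet1 m n π → ℝ)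
    (z : Jet1 m n π) :
    legForm η L z ∈ horizontalForms (X := Rn m) (Y := Rn (m + n)) π 2 m z.pt := by
  rw [mem_horizontal]
  intro v s hs hv
  obtain ⟨i, j, hij, rfl⟩ := Finset.card_eq_two.1 hs
  have hi := hv i (by simp)
  have hj := hv j (by simp)
  change L z * η (π z.pt) (fun l => mfderiv (𝓡 (m + n)) (𝓡 m) π z.pt (v l)) + ∑ k, η (π z.pt)
    (fun l => mfderiv (𝓡 (m + n)) (𝓡 m) π z.pt
      (Function.update v k (z.map (vertEndo L z (v k))) l)) = 0
  rw [(η (π z.pt)).map_coord_zero i hi, mul_zero, zero_add]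
  refine Finset.sum_eq_zero fun k _ => ?_
  rcases eq_or_ne k i with rfl | hk
  · exact (η (π z.pt)).map_coord_zero j (by rw [Function.update_of_ne hij.symm]; exact hj)
  · exact (η (π z.pt)).map_coord_zero i (by rw [Function.update_of_ne hk.symm]; exact hi)

/-- The extended Legendre transform `Leg_𝓛 : J¹π → 𝓜π`. -/
def Leg (η : ∀ x : M, TangentSpace (𝓡 m) x [⋀^Fin m]→L[ℝ] ℝ) (L : Jet1 m n π → ℝ)
    (z : Jet1 m n π) : Mom m n π :=
  ⟨z.pt, ⟨legForm η L z, legForm_mem η L z⟩⟩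

/-- The reduced Legendre transform `leg_𝓛 = μ ∘ Leg_𝓛 : J¹π → 𝓜°π`. -/
def leg (η : ∀ x : M, TangentSpace (𝓡 m) x [⋀^Fin m]→L[ℝ] ℝ) (L : Jet1 m n π → ℝ)
    (z : Jet1 m n π) : RedMom m n π :=
  (Leg η L z).toRed

/-- The density `L η` is hyperregular: its reduced Legendre transform is a diffeomorphism. -/
def IsHyperregular (η : ∀ x : M, TangentSpace (𝓡 m) x [⋀^Fin m]→L[ℝ] ℝ)
    (L : Jet1 m n π → ℝ) : Prop :=
  ∃ Φ : Diffeomorph 𝓘(ℝ, JetModel m n) 𝓘(ℝ, Adap m n × (Fin m → Fin n → ℝ))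
    (Jet1 m n π) (RedMom m n π) ∞, ⇑Φ = leg η L

variable {η : ∀ x : M, TangentSpace (𝓡 m) x [⋀^Fin m]→L[ℝ] ℝ} {L : Jet1 m n π → ℝ}

/-- The inverse of the reduced Legendre transform. -/
def IsHyperregular.legInv (h : IsHyperregular η L) : RedMom m n π → Jet1 m n π :=
  h.choose.symm

theorem IsHyperregular.leg_legInv (h : IsHyperregular η L) (b : RedMom m n π) :
    leg η L (h.legInv b) = b := by
  rw [← h.choose_spec]
  exact h.choose.apply_symm_apply b

theorem IsHyperregular.legInv_pt (h : IsHyperregular η L) (β : Mom m n π) :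
    (h.legInv β.toRed).pt = β.pt :=
  congrArg RedMom.pt (h.leg_legInv β.toRed)

/-- The Hamiltonian density
`𝓗(ω) = ⟨ω, leg_𝓛⁻¹(μ(ω))⟩ η - 𝓛(leg_𝓛⁻¹(μ(ω)))` of a hyperregular density `𝓛 = L η`. -/
def hamDensity (h : IsHyperregular η L) (β : Mom m n π) :
    TangentSpace (𝓡 m) (π β.pt) [⋀^Fin m]→L[ℝ] ℝ :=
  β.pullback (h.legInv β.toRed) (h.legInv_pt β) - L (h.legInv β.toRed) • η (π β.pt)

/-- The semibasic `m`-form on `𝓜π` given by the Hamiltonian density. -/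
def hamForm (h : IsHyperregular η L) (β : Mom m n π) :
    TangentSpace 𝓘(ℝ, MomModel m n) β [⋀^Fin m]→L[ℝ] ℝ :=
  (hamDensity h β).compContinuousLinearMap
    (mfderiv 𝓘(ℝ, MomModel m n) (𝓡 m) (fun β : Mom m n π => π β.pt) β)

/-- The section `-d𝓗` of `Λᵐ⁺¹ 𝓜π`. -/
def negdHam (h : IsHyperregular η L) (β : Mom m n π) :
    FormBundle (MomModel m n) (Mom m n π) (m + 1) :=
  ⟨β, -extD (hamForm h) β⟩

/-! ### The two structural maps of the triple -/

/-- The tautological `m`-form `Θ` of `𝓜π`. -/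
def tautForm (β : Mom m n π) : TangentSpace 𝓘(ℝ, MomModel m n) β [⋀^Fin m]→L[ℝ] ℝ :=
  β.form.1.compContinuousLinearMap
    (mfderiv 𝓘(ℝ, MomModel m n) (𝓡 (m + n)) (Mom.pt : Mom m n π → E) β)

/-- The canonical multisymplectic form `Ω = -dΘ` of `𝓜π`. -/
def canForm (β : Mom m n π) : TangentSpace 𝓘(ℝ, MomModel m n) β [⋀^Fin (m + 1)]→L[ℝ] ℝ :=
  -extD tautForm β

variable (m n π) in
/-- The first jet bundle `J¹(π ∘ ν)`, where `ν : 𝓜π → E` is the projection. -/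
abbrev JetMom : Type _ :=
  Jet (M := M) (E := Mom m n π) (Rn m) (MomModel m n) (fun β => π β.pt)

/-- The map `♭_Ω : J¹(π ∘ ν) → Λᵐ⁺¹ 𝓜π`, `♭_Ω(z) = i_{h_z} Ω - (m - 1) Ω`, where
`h_z = z ∘ T(π ∘ ν)` is the horizontal projector of `z`. -/
def flatMap (j : JetMom m n π) : FormBundle (MomModel m n) (Mom m n π) (m + 1) :=
  ⟨j.pt, derivAction
      (j.map.comp (mfderiv 𝓘(ℝ, MomModel m n) (𝓡 m) (fun β : Mom m n π => π β.pt) j.pt))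
      (canForm j.pt) - ((m : ℝ) - 1) • canForm j.pt⟩

/-- The prolongation `j¹ν : J¹(π ∘ ν) → J¹π` of the projection `ν : 𝓜π → E`. -/
def jetProj (j : JetMom m n π) : Jet1 m n π where
  pt := j.pt.pt
  map := (mfderiv 𝓘(ℝ, MomModel m n) (𝓡 (m + n)) (Mom.pt : Mom m n π → E) j.pt).comp j.map
  isSection := by
    have h := mfderiv_comp j.pt (g := π) (f := (Mom.pt : Mom m n π → E))
      (IsFibration.mdifferentiableAt (m := m) (n := n) inferInstance j.pt.pt)
      ((Mom.natBundle m n π).contMDiff_proj.mdifferentiableAt (by simp))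
    have h2 := j.isSection
    refine Eq.trans ?_ h2
    ext1 v
    exact (DFunLike.congr_fun h (j.map v)).symm

/-- The coordinates `pⁱ_α` of `ω`, in the natural chart at `ω`. -/
def momCoord (β : Mom m n π) (i : Fin m) (a : Fin n) : ℝ :=
  (chartAt (MomModel m n) β β).2.2 i a

/-- The coordinates `pⁱ_{αj}` of a jet of `π ∘ ν` at `ω`, in the natural chart at `ω`: the component
along `∂/∂pⁱ_α` of the image of `∂/∂xʲ`. -/
def momVel (j : JetMom m n π) (i : Fin m) (a : Fin n) (k : Fin m) : ℝ :=
  (j.map ((adaptedAt m n π j.pt.pt).Dfsymm (π j.pt.pt) (stdBasis k)) : MomModel m n).2.2 i a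

/-- The linear form `pⁱ_{αi} duᵅ + pⁱ_α duᵅᵢ`. -/
def tulCovector (j : JetMom m n π) : JetModel m n →L[ℝ] ℝ :=
  ∑ a, (∑ i, momVel j i a i) • (EuclideanSpace.proj a : Rn n →L[ℝ] ℝ).comp
      ((ContinuousLinearMap.snd ℝ (Rn m) (Rn n)).comp
        (ContinuousLinearMap.fst ℝ (Adap m n) (Rn m →L[ℝ] Rn n))) +
    ∑ i, ∑ a, momCoord j.pt i a • (EuclideanSpace.proj a : Rn n →L[ℝ] ℝ).comp
      ((ContinuousLinearMap.apply ℝ (Rn n) (stdBasis i : Rn m)).comp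
        (ContinuousLinearMap.snd ℝ (Adap m n) (Rn m →L[ℝ] Rn n)))

/-- The wedge product `α ∧ β` of a linear form and a `k`-form:
`(α ∧ β)(v₀, …, v_k) = ∑ᵢ (-1)ⁱ α(vᵢ) β(v₀, …, v̂ᵢ, …, v_k)`. -/
def wedge {V : Type*} [NormedAddCommGroup V] [NormedSpace ℝ V] {k : ℕ} (α : V →L[ℝ] ℝ)
    (β : V [⋀^Fin k]→L[ℝ] ℝ) : V [⋀^Fin (k + 1)]→L[ℝ] ℝ :=
  ContinuousAlternatingMap.alternatizeUncurryFin (α.smulRight β)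

/-- The Tulczyjew morphism `A_π^η : J¹(π ∘ ν) → Λᵐ⁺¹ J¹π`, over `j¹ν`,
`(xⁱ, uᵅ, p, pⁱ_α, uᵅⱼ, pⱼ, pⁱ_{αj}) ↦ (pⁱ_{αi} duᵅ + pⁱ_α duᵅᵢ) ∧ dᵐx`. The formula is the same in all
natural coordinates; those of the chart at the point are used here. -/
def tulMap (j : JetMom m n π) : FormBundle (JetModel m n) (Jet1 m n π) (m + 1) :=
  ⟨jetProj j, (wedge (tulCovector j) ((stdVol m).compContinuousLinearMap
    ((ContinuousLinearMap.fst ℝ (Rn m) (Rn n)).comp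
      (ContinuousLinearMap.fst ℝ (Adap m n) (Rn m →L[ℝ] Rn n)))) :
        JetModel m n [⋀^Fin (m + 1)]→L[ℝ] ℝ)⟩

/-- The subset `S_𝓛 = (A_π^η)⁻¹(d𝓛(J¹π))` of `J¹(π ∘ ν)`. -/
def lagSubmanifold (η : ∀ x : M, TangentSpace (𝓡 m) x [⋀^Fin m]→L[ℝ] ℝ) (L : Jet1 m n π → ℝ) :
    Set (JetMom m n π) :=
  tulMap ⁻¹' range (dLag η L)

/-- The subset `S_𝓗 = ♭_Ω⁻¹(-d𝓗(𝓜π))` of `J¹(π ∘ ν)`. -/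
def hamSubmanifold (h : IsHyperregular η L) : Set (JetMom m n π) :=
  flatMap ⁻¹' range (negdHam h)

end Dynamics

end CFT

end

noncomputable section

namespace CFT

/-! ### Top-degree forms and wedge products -/

section Wedge

/-! Fix a jet `j` of `π ∘ ν` at `ω` and work in the natural charts at the points involved. Write `η
= ρ dᵐx` and `ℓ = ρ L`, so that `𝓛 = ℓ dᵐx`. Each of the two membership conditions becomes an
identity `α ∧ dᵐx = α' ∧ dᵐx` at a point. By `wedge_volPullback_eq_iff`, this says that `α` and `α'`
agree on the vectors that are vertical over `M`.

Lagrangian side. Since `d𝓛 = dℓ ∧ dᵐx`, `mem_lagSubmanifold_iff` gives `pⁱ_{αi} = ∂ℓ/∂uᵅ` and `pⁱ_α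
= ∂ℓ/∂uᵅᵢ`, taken at the jet `j¹ν(j)`. By `fderiv_localLag_eq_sum`, the functions `∂ℓ/∂uᵅᵢ` are the
coordinates of `leg_𝓛`. The second family of equations therefore says `leg_𝓛(j¹ν(j)) = μ(ω)`.

Hamiltonian side. In coordinates, `dΘ = dp ∧ dᵐx + dpⁱ_α ∧ duᵅ ∧ dᵐ⁻¹xᵢ`. It vanishes on any three
vertical vectors. On arguments that are each horizontal or vertical, `s` of them vertical, `i_h`
multiplies it by `m + 1 - s`. Subtracting `m - 1` times the form leaves the factor `2 - s`, so only
`s = 1` survives. This is `derivAction_sub_eq_wedge`, and it yields `♭_Ω(j) = -(dp - pⁱ_{αi} duᵅ +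
uᵅᵢ dpⁱ_α) ∧ dᵐx`. On the other side `𝓗 = H dᵐx` with `H = p + pⁱ_α Gᵅᵢ - ℓ ∘ G`, where `G` is the
local expression of `leg_𝓛⁻¹ ∘ μ`. As in classical mechanics, the terms containing the derivative of
the fibre part of `G` cancel, because `∂ℓ/∂uᵅᵢ` at `G` is `pⁱ_α`. Hence `fderiv_localHam`: `∂H/∂p =
1`, `∂H/∂pⁱ_α = Gᵅᵢ` and `∂H/∂uᵅ = -∂ℓ/∂uᵅ`. The equations become `uᵅᵢ = Gᵅᵢ` and `pⁱ_{αi} = ∂ℓ/∂uᵅ`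
at `G`, the `dp` equation being empty.

Comparison. Both `uᵅᵢ = Gᵅᵢ` and `pⁱ_α = ∂ℓ/∂uᵅᵢ` say that `leg_𝓛⁻¹(μ(ω)) = j¹ν(j)`, since `leg_𝓛`
is bijective. Once this holds, the remaining equations on the two sides are the same. -/

theorem eq_smul_stdVol {m : ℕ} (β : Rn m [⋀^Fin m]→L[ℝ] ℝ) : β = β stdBasis • stdVol m := by
  apply ContinuousAlternatingMap.toAlternatingMap_injective
  have h := β.toAlternatingMap.eq_smul_basis_det (EuclideanSpace.basisFun (Fin m) ℝ).toBasis
  have h2 : ⇑(EuclideanSpace.basisFun (Fin m) ℝ).toBasis = (stdBasis : Fin m → Rn m) := by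
    ext i; simp [stdBasis]
  rw [h2] at h
  exact h

variable {V : Type*} [NormedAddCommGroup V] [NormedSpace ℝ V] {m : ℕ}

theorem wedge_apply {k : ℕ} (α : V →L[ℝ] ℝ) (β : V [⋀^Fin k]→L[ℝ] ℝ) (v : Fin (k + 1) → V) :
    wedge α β v = ∑ i : Fin (k + 1), (-1) ^ (i : ℕ) * (α (v i) * β (i.removeNth v)) := by
  simp [wedge, ContinuousAlternatingMap.alternatizeUncurryFin_apply]

/-- A form of degree greater than `m` vanishes on vectors in the image of `ℝᵐ`. -/
theorem apply_comp_eq_zero (γ : Rn m →L[ℝ] V) (β : V [⋀^Fin (m + 1)]→L[ℝ] ℝ)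
    (w : Fin (m + 1) → Rn m) : β (fun i => γ (w i)) = 0 := by
  refine (β.compContinuousLinearMap γ).toAlternatingMap.map_linearDependent w fun h => ?_
  have := h.fintype_card_le_finrank
  simp at this

/-- Two forms agree when they agree on families of vectors that are either horizontal or
vertical. -/
theorem ext_of_horizontal_or_vertical {k : ℕ} {pr : V →L[ℝ] Rn m} {γ : Rn m →L[ℝ] V}
    (hγ : ∀ w, pr (γ w) = w) {β β' : V [⋀^Fin k]→L[ℝ] ℝ}
    (h : ∀ v : Fin k → V, (∀ i, (∃ w, v i = γ w) ∨ pr (v i) = 0) → β v = β' v) : β = β' := by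
  ext v
  have hv : v = (fun i => γ (pr (v i))) + fun i => v i - γ (pr (v i)) := by
    ext i; simp
  rw [hv]
  -- Expanding by multilinearity gives one term for each set `s` of indices: the arguments in `s`
  -- are the horizontal parts, the others the vertical parts.
  have e1 := β.toMultilinearMap.map_add_univ (fun i => γ (pr (v i)))
    fun i => v i - γ (pr (v i))
  have e2 := β'.toMultilinearMap.map_add_univ (fun i => γ (pr (v i)))
    fun i => v i - γ (pr (v i))
  refine e1.trans (Eq.trans ?_ e2.symm)
  refine Finset.sum_congr rfl fun s _ => h _ fun i => ?_
  by_cases hi : i ∈ s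
  · exact Or.inl ⟨pr (v i), by simp [hi]⟩
  · exact Or.inr (by simp [hi, hγ])

/-- `dᵐx` on `V`. -/
abbrev volPullback (pr : V →L[ℝ] Rn m) : V [⋀^Fin m]→L[ℝ] ℝ :=
  (stdVol m).compContinuousLinearMap pr

theorem volPullback_apply (pr : V →L[ℝ] Rn m) (v : Fin m → V) :
    volPullback pr v = stdVol m (fun i => pr (v i)) := rfl

theorem volPullback_eq_zero {pr : V →L[ℝ] Rn m} {v : Fin m → V} {i : Fin m} (h : pr (v i) = 0) :
    volPullback pr v = 0 := by
  rw [volPullback_apply]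
  exact (stdVol m).map_coord_zero i h

/-- If only `v i` is vertical, only one term of `α ∧ dᵐx` survives. -/
theorem wedge_volPullback_apply {pr : V →L[ℝ] Rn m} (α : V →L[ℝ] ℝ) (v : Fin (m + 1) → V)
    (i : Fin (m + 1)) (hi : pr (v i) = 0) :
    wedge α (volPullback pr) v =
      (-1) ^ (i : ℕ) * (α (v i) * volPullback pr (i.removeNth v)) := by
  rw [wedge_apply, Finset.sum_eq_single i]
  · intro j _ hj
    -- Removing `v j` with `j ≠ i` leaves the vertical vector `v i` among the arguments of `dᵐx`.
    obtain ⟨l, rfl⟩ := Fin.exists_succAbove_eq hj.symm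
    rw [volPullback_eq_zero (i := l) hi]
    simp
  · simp

/-- The lifted standard frame has `dᵐx`-volume `1`, so this family of arguments recovers `α` on
vertical vectors from `α ∧ dᵐx`. -/
theorem wedge_volPullback_cons {pr : V →L[ℝ] Rn m} {γ : Rn m →L[ℝ] V} (hγ : ∀ w, pr (γ w) = w)
    (α : V →L[ℝ] ℝ) {k : V} (hk : pr k = 0) :
    wedge α (volPullback pr) (Matrix.vecCons k fun i => γ (stdBasis i)) = α k := by
  rw [wedge_volPullback_apply α _ 0 (by simpa using hk)]
  have : volPullback pr (Fin.removeNth (0 : Fin (m + 1))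
      (Matrix.vecCons k fun i => γ (stdBasis i))) = 1 := by
    rw [volPullback_apply]
    simp [Fin.removeNth_apply, hγ, stdVol_basis]
  rw [this]
  simp

/-- The forms `α ∧ dᵐx` and `α' ∧ dᵐx` agree if and only if `α` and `α'` agree on vertical
vectors. -/
theorem wedge_volPullback_eq_iff {pr : V →L[ℝ] Rn m} {γ : Rn m →L[ℝ] V}
    (hγ : ∀ w, pr (γ w) = w) {α α' : V →L[ℝ] ℝ} :
    wedge α (volPullback pr) = wedge α' (volPullback pr) ↔ ∀ k, pr k = 0 → α k = α' k := by
  constructor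
  · intro h k hk
    rw [← wedge_volPullback_cons hγ α hk, h, wedge_volPullback_cons hγ α' hk]
  · intro h
    refine ext_of_horizontal_or_vertical hγ fun v hv => ?_
    by_cases hex : ∃ i, pr (v i) = 0
    · obtain ⟨i, hi⟩ := hex
      rw [wedge_volPullback_apply _ _ i hi, wedge_volPullback_apply _ _ i hi, h _ hi]
    · push Not at hex
      choose w hw using fun i => (hv i).resolve_right (hex i)
      obtain rfl : v = fun i => γ (w i) := funext hw
      rw [apply_comp_eq_zero, apply_comp_eq_zero]

/-- With one vertical argument held fixed, `β` restricted to the image of `γ` is a form of top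
degree on `ℝᵐ`. It is therefore determined by its value on the lifted standard frame, which is what
`τ` records. -/
theorem apply_of_vertical {pr : V →L[ℝ] Rn m} {γ : Rn m →L[ℝ] V} (hγ : ∀ w, pr (γ w) = w)
    (β : V [⋀^Fin (m + 1)]→L[ℝ] ℝ) {τ : V →L[ℝ] ℝ}
    (hτ : ∀ k, pr k = 0 → τ k = β (Matrix.vecCons k fun i => γ (stdBasis i)))
    (v : Fin (m + 1) → V) (i : Fin (m + 1)) (hi : pr (v i) = 0)
    (hv : ∀ j, j ≠ i → ∃ w, v j = γ w) : β v = wedge τ (volPullback pr) v := by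
  choose w hw using fun l : Fin m => hv (i.succAbove l) (Fin.succAbove_ne i l)
  have hrem : i.removeNth v = fun l => γ (w l) := funext hw
  rw [wedge_volPullback_apply τ v i hi, hrem, hτ _ hi]
  -- Moving the vertical vector to the first slot costs the same sign that it carries in the wedge
  -- product.
  have e1 : β v = (-1) ^ (i : ℕ) * β (Matrix.vecCons (v i) fun l => γ (w l)) := by
    have := β.toAlternatingMap.map_insertNth i (v i) (fun l => γ (w l))
    rw [← hrem, Fin.insertNth_self_removeNth, hrem] at this
    simpa using this
  have e2 := DFunLike.congr_fun
    (eq_smul_stdVol ((β.curryLeft (v i)).compContinuousLinearMap γ)) w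
  change β (Matrix.vecCons (v i) fun l => γ (w l)) =
    β (Matrix.vecCons (v i) fun l => γ (stdBasis l)) * stdVol m w at e2
  rw [e1, e2, volPullback_apply]
  simp only [hγ]

/-- For a `3`-horizontal form `β` of degree `m + 1` and the horizontal projector `h = γ ∘ pr`,
the form `i_h β - (m - 1) β` is semibasic, and equal to `τ ∧ dᵐx`, where `τ` is obtained from the
contraction of `β` with the horizontal vectors. -/
theorem derivAction_sub_eq_wedge {pr : V →L[ℝ] Rn m} {γ : Rn m →L[ℝ] V}
    (hγ : ∀ w, pr (γ w) = w) {β : V [⋀^Fin (m + 1)]→L[ℝ] ℝ}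
    (hβ : β ∈ horizontal pr 3 (m + 1)) {τ : V →L[ℝ] ℝ}
    (hτ : ∀ k, pr k = 0 → τ k = β (Matrix.vecCons k fun i => γ (stdBasis i))) :
    derivAction (γ.comp pr) β - ((m : ℝ) - 1) • β = wedge τ (volPullback pr) := by
  classical
  refine ext_of_horizontal_or_vertical hγ fun v hv => ?_
  set S : Finset (Fin (m + 1)) := {i | pr (v i) = 0} with hS
  have hmem : ∀ i, i ∈ S ↔ pr (v i) = 0 := fun i => by simp [hS]
  -- The projector fixes horizontal arguments and kills vertical ones, so the derivation counts the
  -- horizontal arguments.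
  have hder : derivAction (γ.comp pr) β v = ((m + 1 : ℝ) - S.card) * β v := by
    have hterm : ∀ i, β (Function.update v i (γ.comp pr (v i))) = if i ∈ Sᶜ then β v else 0 := by
      intro i
      by_cases hi : pr (v i) = 0
      · rw [if_neg (by simp [hmem, hi])]
        exact β.map_coord_zero i (by simp [hi])
      · rw [if_pos (by simp [hmem, hi])]
        obtain ⟨w, hw⟩ := (hv i).resolve_right hi
        have : γ.comp pr (v i) = v i := by simp [hw, hγ]
        rw [this, Function.update_eq_self]
    rw [derivAction_apply, Finset.sum_congr rfl fun i _ => hterm i, Finset.sum_ite_mem,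
      Finset.univ_inter, Finset.sum_const, Finset.card_compl, Fintype.card_fin, nsmul_eq_mul,
      Nat.cast_sub (by simpa using S.card_le_univ)]
    push_cast
    rfl
  rw [ContinuousAlternatingMap.sub_apply, ContinuousAlternatingMap.smul_apply, hder, smul_eq_mul]
  -- The constant `m - 1` is chosen so that the factor is `1` for one vertical argument and `0` for
  -- two. With none, both sides vanish because `m + 1` exceeds the dimension of the base. With three
  -- or more, `β` vanishes by hypothesis. The wedge product vanishes as soon as there are two.
  have key : ((m + 1 : ℝ) - S.card) * β v - ((m : ℝ) - 1) * β v = (2 - S.card) * β v := by ring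
  rw [key]
  have hwedge : 2 ≤ S.card → wedge τ (volPullback pr) v = 0 := by
    intro h2
    obtain ⟨i, hi, j, hj, hij⟩ := Finset.one_lt_card.1 h2
    rw [wedge_volPullback_apply τ v i ((hmem i).1 hi)]
    obtain ⟨l, rfl⟩ := Fin.exists_succAbove_eq hij.symm
    rw [volPullback_eq_zero (i := l) ((hmem _).1 hj)]
    simp
  rcases lt_trichotomy S.card 2 with hlt | heq | hgt
  · interval_cases hc : S.card
    · have hemp := Finset.card_eq_zero.1 hc
      choose w hw using fun i => (hv i).resolve_right fun h => by
        have := (hmem i).2 h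
        simp [hemp] at this
      obtain rfl : v = fun i => γ (w i) := funext hw
      rw [apply_comp_eq_zero, apply_comp_eq_zero, mul_zero]
    · obtain ⟨i, hi⟩ := Finset.card_eq_one.1 hc
      rw [apply_of_vertical hγ β hτ v i ((hmem i).1 (by simp [hi]))]
      · norm_num
      · intro j hj
        refine (hv j).resolve_right fun h => hj ?_
        have := (hmem j).2 h
        simpa [hi] using this
  · rw [heq, hwedge heq.ge]; norm_num
  · rw [hwedge hgt.le]
    obtain ⟨T, hTS, hT⟩ := Finset.exists_subset_card_eq (Nat.succ_le_of_lt hgt)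
    rw [hβ v T hT fun i hi => (hmem i).1 (hTS hi), mul_zero]

end Wedge

/-! ### The local expression of the canonical form -/

section Canonical

variable {m n : ℕ}

theorem coordForm_add (q q' : ℝ × (Fin m → Fin n → ℝ)) :
    coordForm (q + q') = coordForm q + coordForm q' := by
  have hend : ∀ v : Adap m n, (momEndo (q + q').2 v).1 = (momEndo q.2 v).1 + (momEndo q'.2 v).1 := by
    intro v
    ext i
    simp [momEndo_fst, add_mul, Finset.sum_add_distrib]
  ext v
  rw [ContinuousAlternatingMap.add_apply]
  simp only [coordForm_apply, hend, ContinuousAlternatingMap.map_update_add,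
    Finset.sum_add_distrib, Prod.fst_add]
  ring

theorem coordForm_smul (r : ℝ) (q : ℝ × (Fin m → Fin n → ℝ)) :
    coordForm (r • q) = r • coordForm q := by
  have hend : ∀ v : Adap m n, (momEndo (r • q).2 v).1 = r • (momEndo q.2 v).1 := by
    intro v
    ext i
    simp [momEndo_fst, Finset.mul_sum, mul_assoc]
  ext v
  rw [ContinuousAlternatingMap.smul_apply]
  simp only [coordForm_apply, hend, ContinuousAlternatingMap.map_update_smul, Prod.smul_fst,
    smul_eq_mul, mul_add, Finset.mul_sum, mul_assoc]

/-- The map that sends the coordinates of a form to the form, as a continuous linear map. -/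
def coordFormL : (ℝ × (Fin m → Fin n → ℝ)) →L[ℝ] Adap m n [⋀^Fin m]→L[ℝ] ℝ :=
  LinearMap.toContinuousLinearMap
    { toFun := coordForm
      map_add' := coordForm_add
      map_smul' := coordForm_smul }

/-- The value of the form with coordinates `q` on the horizontal lift of the standard frame along
a jet with coordinates `a`. -/
theorem coordForm_graph (q : ℝ × (Fin m → Fin n → ℝ)) (a : Fin m → Rn n) :
    coordForm q (fun i => ((stdBasis i, a i) : Adap m n)) = q.1 + ∑ i, ∑ b, q.2 i b * a i b := by
  rw [coordForm_apply]
  change q.1 * stdVol m stdBasis + ∑ k, stdVol m (Function.update stdBasis k _) = _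
  simp only [stdVol_basis, mul_one, stdVol_update, momEndo_fst]

/-- The value of the form with coordinates `q` on a horizontal frame in which one vector is replaced
by a vertical one. -/
theorem coordForm_update (q : ℝ × (Fin m → Fin n → ℝ)) (a : Fin m → Rn n) (l : Fin m) (b : Rn n) :
    coordForm q (Function.update (fun i => ((stdBasis i, a i) : Adap m n)) l (0, b)) =
      ∑ c, q.2 l c * b c := by
  rw [coordForm_apply, (stdVol m).map_coord_zero l (by simp), mul_zero, zero_add,
    Finset.sum_eq_single l]
  · have : Function.update (fun i => ((Function.update (fun i => ((stdBasis i, a i) : Adap m n)) l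
        (0, b)) i).1) l (momEndo q.2 ((Function.update (fun i => ((stdBasis i, a i) : Adap m n)) l
        (0, b)) l)).1 = Function.update stdBasis l (momEndo q.2 (0, b)).1 := by
      ext i : 1
      rcases eq_or_ne i l with rfl | h
      · simp
      · simp [Function.update_of_ne h]
    rw [this, stdVol_update, momEndo_fst]
  · intro k _ hk
    exact (stdVol m).map_coord_zero l (by simp [Function.update_of_ne hk.symm])
  · simp

variable (m n) in
/-- The projection `(xⁱ, uᵅ, …) ↦ (xⁱ)` on the model space of a natural bundle. -/
abbrev baseProj (F : Type*) [NormedAddCommGroup F] [NormedSpace ℝ F] :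
    (Adap m n × F) →L[ℝ] Rn m :=
  (ContinuousLinearMap.fst ℝ (Rn m) (Rn n)).comp (ContinuousLinearMap.fst ℝ (Adap m n) F)

/-- The local expression `dp ∧ dᵐx + dpⁱ_α ∧ duᵅ ∧ dᵐ⁻¹xᵢ` of `dΘ`. -/
def localdTaut (m n : ℕ) : MomModel m n [⋀^Fin (m + 1)]→L[ℝ] ℝ :=
  ContinuousAlternatingMap.alternatizeUncurryFin
    ((ContinuousAlternatingMap.compContinuousLinearMapCLM
      (ContinuousLinearMap.fst ℝ (Adap m n) (ℝ × (Fin m → Fin n → ℝ)))).comp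
      (coordFormL.comp (ContinuousLinearMap.snd ℝ (Adap m n) (ℝ × (Fin m → Fin n → ℝ)))))

theorem localdTaut_apply (v : Fin (m + 1) → MomModel m n) :
    localdTaut m n v =
      ∑ i : Fin (m + 1), (-1) ^ (i : ℕ) * coordForm (v i).2 (fun l => (v (i.succAbove l)).1) := by
  rw [localdTaut, ContinuousAlternatingMap.alternatizeUncurryFin_apply]
  refine Finset.sum_congr rfl fun i _ => ?_
  rw [zsmul_eq_mul]
  push_cast
  rfl

/-- Each term of the alternating sum uses one argument to form the coefficients. At least two of
three vertical arguments remain, and the forms `coordForm` are `2`-horizontal. -/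
theorem localdTaut_mem : localdTaut m n ∈ horizontal (baseProj m n _) 3 (m + 1) := by
  classical
  intro v s hs hv
  rw [localdTaut_apply]
  refine Finset.sum_eq_zero fun i _ => ?_
  have hcard : 1 < (s.erase i).card := by
    have := Finset.pred_card_le_card_erase (s := s) (a := i)
    omega
  obtain ⟨j, hj, k, hk, hjk⟩ := Finset.one_lt_card.1 hcard
  obtain ⟨j, rfl⟩ := Fin.exists_succAbove_eq (Finset.ne_of_mem_erase hj)
  obtain ⟨k, rfl⟩ := Fin.exists_succAbove_eq (Finset.ne_of_mem_erase hk)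
  have hjk' : j ≠ k := fun h => hjk (by rw [h])
  rw [coordForm_mem (v i).2 _ {j, k} (Finset.card_pair hjk'), mul_zero]
  intro l hl
  rcases Finset.mem_insert.1 hl with rfl | hl
  · exact hv _ (Finset.mem_of_mem_erase hj)
  · rw [Finset.mem_singleton.1 hl]
    exact hv _ (Finset.mem_of_mem_erase hk)

/-- The contraction of `dΘ` with a horizontal frame. -/
theorem localdTaut_vecCons {γ : Rn m →L[ℝ] MomModel m n} (hγ : ∀ w, (γ w).1.1 = w)
    {k : MomModel m n} (hk : k.1.1 = 0) :
    localdTaut m n (Matrix.vecCons k fun i => γ (stdBasis i)) =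
      k.2.1 + ∑ i, ∑ a, k.2.2 i a * (γ (stdBasis i)).1.2 a -
        ∑ i, ∑ a, (γ (stdBasis i)).2.2 i a * k.1.2 a := by
  have hfr : (fun i => (γ (stdBasis i)).1) =
      fun i => ((stdBasis i, (γ (stdBasis i)).1.2) : Adap m n) := by
    ext1 i
    exact Prod.ext (hγ _) rfl
  -- The term of index `0` differentiates the coefficients along `k` and gives `dp + uᵅᵢ dpⁱ_α`. In
  -- each other term a frame vector is used for the coefficients and `k` takes its place among the
  -- arguments, which gives `-pⁱ_{αi} duᵅ`.
  rw [localdTaut_apply, Fin.sum_univ_succ, sub_eq_add_neg, ← Finset.sum_neg_distrib]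
  congr 1
  · simp only [Fin.val_zero, pow_zero, one_mul, Matrix.cons_val_zero, Fin.zero_succAbove,
      Matrix.cons_val_succ]
    rw [hfr, coordForm_graph]
  · refine Finset.sum_congr rfl fun l _ => ?_
    -- Removing an entry from a family indexed by `Fin m` needs `m` in successor form; the index `l`
    -- shows that `m` is positive.
    obtain ⟨m, rfl⟩ : ∃ m', m = m' + 1 := ⟨m - 1, by have := l.2; omega⟩
    have e1 : (fun i => (Matrix.vecCons k (fun i => γ (stdBasis i)) (l.succ.succAbove i)).1) =
        Matrix.vecCons k.1 (l.removeNth fun i => (γ (stdBasis i)).1) := by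
      ext1 i
      refine Fin.cases ?_ (fun i => ?_) i
      · simp
      · simp [Fin.removeNth_apply]
    have e2 := (coordForm (γ (stdBasis l)).2).toAlternatingMap.neg_one_pow_smul_map_insertNth l k.1
      (l.removeNth fun i => (γ (stdBasis i)).1)
    rw [Fin.insertNth_removeNth] at e2
    have e3 : k.1 = (0, k.1.2) := Prod.ext hk rfl
    rw [e1]
    simp only [Matrix.cons_val_succ, Fin.val_succ]
    rw [← coordForm_update (γ (stdBasis l)).2 (fun i => (γ (stdBasis i)).1.2) l k.1.2, ← hfr, ← e3]
    change _ * (coordForm (γ (stdBasis l)).2).toAlternatingMap _ = _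
    rw [← e2, zsmul_eq_mul, Int.cast_pow, Int.cast_neg, Int.cast_one, ← mul_assoc, ← pow_add]
    -- The sign `(-1)^(l+1)` of the alternating sum and the sign `(-1)^l` from moving `k` back into
    -- slot `l` combine to `-1`.
    rw [show (l : ℕ) + 1 + l = 2 * l + 1 by ring, pow_succ, pow_mul]
    simp

/-- The linear form `dp - pⁱ_{αi} duᵅ + uᵅᵢ dpⁱ_α`. -/
def hamCovector (γ : Rn m →L[ℝ] MomModel m n) : MomModel m n →L[ℝ] ℝ :=
  LinearMap.toContinuousLinearMap
    { toFun := fun k => k.2.1 + ∑ i, ∑ a, k.2.2 i a * (γ (stdBasis i)).1.2 a -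
        ∑ i, ∑ a, (γ (stdBasis i)).2.2 i a * k.1.2 a
      map_add' := fun k k' => by
        simp only [Prod.fst_add, Prod.snd_add, Pi.add_apply, PiLp.add_apply, add_mul, mul_add,
          Finset.sum_add_distrib]
        ring
      map_smul' := fun r k => by
        simp only [Prod.smul_fst, Prod.smul_snd, Pi.smul_apply, PiLp.smul_apply, smul_eq_mul,
          RingHom.id_apply, mul_sub, mul_add, Finset.mul_sum]
        congr 1
        · simp only [mul_assoc]
        · simp only [mul_left_comm] }

theorem hamCovector_apply (γ : Rn m →L[ℝ] MomModel m n) (k : MomModel m n) :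
    hamCovector γ k = k.2.1 + ∑ i, ∑ a, k.2.2 i a * (γ (stdBasis i)).1.2 a -
        ∑ i, ∑ a, (γ (stdBasis i)).2.2 i a * k.1.2 a := rfl

/-- The contraction of `dΘ` with the frame of the jet is exactly `hamCovector` on vertical vectors.
This identity is therefore the coordinate form of `♭_Ω`, up to the sign in `Ω = -dΘ`. -/
theorem derivAction_localdTaut {γ : Rn m →L[ℝ] MomModel m n} (hγ : ∀ w, (γ w).1.1 = w) :
    derivAction (γ.comp (baseProj m n _)) (localdTaut m n) - ((m : ℝ) - 1) • localdTaut m n =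
      wedge (hamCovector γ) (volPullback (baseProj m n _)) :=
  derivAction_sub_eq_wedge hγ localdTaut_mem fun _ hk => (localdTaut_vecCons hγ hk).symm

end Canonical

/-! ### Tangent maps in natural charts -/

section Charts

/-- This is `d(g β) = dg ∧ β` for a constant form `β`; it is applied to the densities `ℓ dᵐx` and `H
dᵐx`. -/
theorem extDeriv_smul_const {V : Type*} [NormedAddCommGroup V] [NormedSpace ℝ V] {k : ℕ}
    {g : V → ℝ} {y : V} (hg : DifferentiableAt ℝ g y) (β : V [⋀^Fin k]→L[ℝ] ℝ) :
    extDeriv (fun y => g y • β) y = wedge (fderiv ℝ g y) β := by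
  rw [extDeriv, (hg.hasFDerivAt.smul_const β).fderiv]
  rfl

/-- The tangent space at `p` is the model space, identified through the preferred chart at `p`.
Tangent vectors at `p` are thus their own components in that chart. -/
theorem mfderiv_chartAt_self {Y P : Type*} [NormedAddCommGroup Y] [NormedSpace ℝ Y]
    [TopologicalSpace P] [ChartedSpace Y P] [IsManifold 𝓘(ℝ, Y) 1 P] (p : P) (v : Y) :
    (mfderiv 𝓘(ℝ, Y) 𝓘(ℝ, Y) (chartAt Y p) p : Y →L[ℝ] Y) v = v := by
  have h := mfderiv_chartAt_eq_tangentCoordChange (I := 𝓘(ℝ, Y)) (mem_chart_source Y p)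
  have h2 := tangentCoordChange_self (I := 𝓘(ℝ, Y)) (v := v) (mem_extChartAt_source p)
  rw [← h] at h2
  exact h2

theorem mfderiv_chartAt_symm_self {Y P : Type*} [NormedAddCommGroup Y] [NormedSpace ℝ Y]
    [TopologicalSpace P] [ChartedSpace Y P] [IsManifold 𝓘(ℝ, Y) 1 P] (p : P) (v : Y) :
    (mfderiv 𝓘(ℝ, Y) 𝓘(ℝ, Y) (chartAt Y p).symm (chartAt Y p p) : Y →L[ℝ] Y) v = v := by
  have h1 := (mdifferentiable_chart (I := 𝓘(ℝ, Y)) p).symm_comp_deriv (mem_chart_source Y p)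
  have h2 := DFunLike.congr_fun h1 v
  change (mfderiv 𝓘(ℝ, Y) 𝓘(ℝ, Y) (chartAt Y p).symm (chartAt Y p p) : Y →L[ℝ] Y)
    ((mfderiv 𝓘(ℝ, Y) 𝓘(ℝ, Y) (chartAt Y p) p : Y →L[ℝ] Y) v) = v at h2
  rwa [mfderiv_chartAt_self] at h2

/-- Links `vertDeriv`, which is defined by the manifold derivative of `L`, to the partial
derivatives of the local expression of `L`. -/
theorem mfderiv_eq_fderiv_chartAt {Y P : Type*} [NormedAddCommGroup Y] [NormedSpace ℝ Y]
    [TopologicalSpace P] [ChartedSpace Y P] {g : P → ℝ} {p : P}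
    (hg : MDifferentiableAt 𝓘(ℝ, Y) 𝓘(ℝ, ℝ) g p) :
    (mfderiv 𝓘(ℝ, Y) 𝓘(ℝ, ℝ) g p : Y →L[ℝ] ℝ) =
      fderiv ℝ (g ∘ (chartAt Y p).symm) (chartAt Y p p) := by
  rw [hg.mfderiv]
  simp [writtenInExtChartAt, fderivWithin_univ, extChartAt, Function.comp_def, chartAt_self_eq]
  rfl

variable {M E : Type*} [TopologicalSpace M] [TopologicalSpace E] {m n : ℕ}
  [ChartedSpace (Rn m) M] [ChartedSpace (Rn (m + n)) E] {π : E → M}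
  {P F : Type*} [NormedAddCommGroup F] [NormedSpace ℝ F] [TopologicalSpace P]
  [ChartedSpace (Adap m n × F) P]

/-- A chart of `P` that covers an adapted chart of `E`. -/
structure IsNaturalChart (c : AdaptedChart m n π) (proj : P → E)
    (φ : OpenPartialHomeomorph P (Adap m n × F)) : Prop where
  mdifferentiable : φ.MDifferentiable 𝓘(ℝ, Adap m n × F) 𝓘(ℝ, Adap m n × F)
  mdifferentiable_proj : MDifferentiable 𝓘(ℝ, Adap m n × F) (𝓡 (m + n)) proj
  mapsTo : ∀ p ∈ φ.source, proj p ∈ c.e.source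
  fst_apply : ∀ p ∈ φ.source, (φ p).1 = c.e (proj p)

namespace IsNaturalChart

variable {c : AdaptedChart m n π} {proj : P → E} {φ : OpenPartialHomeomorph P (Adap m n × F)}

theorem fst_eq (h : IsNaturalChart c proj φ) {y : Adap m n × F} (hy : y ∈ φ.target) :
    c.e (proj (φ.symm y)) = y.1 := by
  rw [← h.fst_apply _ (φ.map_target hy), φ.right_inv hy]

theorem proj_symm (h : IsNaturalChart c proj φ) {y : Adap m n × F} (hy : y ∈ φ.target) :
    proj (φ.symm y) = c.e.symm y.1 := by
  rw [← h.fst_eq hy, c.e.left_inv (h.mapsTo _ (φ.map_target hy))]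

theorem f_proj_symm (h : IsNaturalChart c proj φ) {y : Adap m n × F} (hy : y ∈ φ.target) :
    c.f (π (proj (φ.symm y))) = y.1.1 := by
  rw [← c.fst_e _ (h.mapsTo _ (φ.map_target hy)), h.fst_eq hy]

/-- In a natural chart over an adapted chart the projection to `E` is the first projection, so `proj
∘ φ.symm` and `c.e.symm ∘ Prod.fst` agree near `y` and have the same derivative. -/
theorem mfderiv_proj (h : IsNaturalChart c proj φ) {y : Adap m n × F} (hy : y ∈ φ.target)
    (v : Adap m n × F) :
    mfderiv 𝓘(ℝ, Adap m n × F) (𝓡 (m + n)) proj (φ.symm y)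
      (mfderiv 𝓘(ℝ, Adap m n × F) 𝓘(ℝ, Adap m n × F) φ.symm y v) =
        c.Dsymm (proj (φ.symm y)) v.1 := by
  have h1 : mfderiv 𝓘(ℝ, Adap m n × F) (𝓡 (m + n)) (proj ∘ φ.symm) y =
      mfderiv 𝓘(ℝ, Adap m n × F) (𝓡 (m + n)) (c.e.symm ∘ Prod.fst) y := by
    apply Filter.EventuallyEq.mfderiv_eq
    filter_upwards [φ.open_target.mem_nhds hy] with y' hy' using h.proj_symm hy'
  rw [mfderiv_comp y (h.mdifferentiable_proj _) (h.mdifferentiable.mdifferentiableAt_symm hy)] at h1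
  have hy1 : y.1 ∈ c.e.target := by
    rw [← h.fst_eq hy]; exact c.e.map_source (h.mapsTo _ (φ.map_target hy))
  have h2 : MDifferentiableAt 𝓘(ℝ, Adap m n × F) 𝓘(ℝ, Adap m n)
      (Prod.fst : Adap m n × F → Adap m n) y := differentiableAt_fst.mdifferentiableAt
  rw [mfderiv_comp y (c.mdiff_e.mdifferentiableAt_symm hy1) h2, mfderiv_eq_fderiv,
    fderiv_fst] at h1
  have h3 := DFunLike.congr_fun h1 v
  refine Eq.trans h3 ?_
  rw [AdaptedChart.Dsymm, h.fst_eq hy]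
  rfl

theorem mfderiv_base [hπ : IsFibration m n π] (h : IsNaturalChart c proj φ) {y : Adap m n × F}
    (hy : y ∈ φ.target) (v : Adap m n × F) :
    mfderiv 𝓘(ℝ, Adap m n × F) (𝓡 m) (fun p => π (proj p)) (φ.symm y)
      (mfderiv 𝓘(ℝ, Adap m n × F) 𝓘(ℝ, Adap m n × F) φ.symm y v) =
        c.Dfsymm (π (proj (φ.symm y))) v.1.1 := by
  rw [← AdaptedChart.mfderiv_Dsymm (h.mapsTo _ (φ.map_target hy)), ← h.mfderiv_proj hy]
  exact DFunLike.congr_fun (mfderiv_comp (φ.symm y) (hπ.mdifferentiableAt _)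
    (h.mdifferentiable_proj _)) _

theorem mfderiv_proj_self [IsManifold 𝓘(ℝ, Adap m n × F) 1 P] {p : P}
    (h : IsNaturalChart c proj (chartAt (Adap m n × F) p)) (v : Adap m n × F) :
    mfderiv 𝓘(ℝ, Adap m n × F) (𝓡 (m + n)) proj p v = c.Dsymm (proj p) v.1 := by
  have h1 := h.mfderiv_proj (mem_chart_target _ p) v
  have h2 := mfderiv_chartAt_symm_self p v
  rw [(chartAt (Adap m n × F) p).left_inv (mem_chart_source _ p)] at h1
  exact (congrArg (mfderiv 𝓘(ℝ, Adap m n × F) (𝓡 (m + n)) proj p) h2).symm.trans h1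

theorem mfderiv_base_self [IsFibration m n π] [IsManifold 𝓘(ℝ, Adap m n × F) 1 P] {p : P}
    (h : IsNaturalChart c proj (chartAt (Adap m n × F) p)) (v : Adap m n × F) :
    mfderiv 𝓘(ℝ, Adap m n × F) (𝓡 m) (fun p => π (proj p)) p v =
      c.Dfsymm (π (proj p)) v.1.1 := by
  have h1 := h.mfderiv_base (mem_chart_target _ p) v
  have h2 := mfderiv_chartAt_symm_self p v
  rw [(chartAt (Adap m n × F) p).left_inv (mem_chart_source _ p)] at h1
  exact (congrArg (mfderiv 𝓘(ℝ, Adap m n × F) (𝓡 m) (fun p => π (proj p)) p) h2).symm.trans h1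

/-- The local expression of a semibasic form. -/
theorem formInChart_base [IsFibration m n π] (h : IsNaturalChart c proj φ)
    (β : ∀ p : P, TangentSpace (𝓡 m) (π (proj p)) [⋀^Fin m]→L[ℝ] ℝ) {y : Adap m n × F}
    (hy : y ∈ φ.target) :
    formInChart φ (fun p => (β p).compContinuousLinearMap
      (mfderiv 𝓘(ℝ, Adap m n × F) (𝓡 m) (fun p => π (proj p)) p)) y =
      (β (φ.symm y) fun i => c.Dfsymm (π (proj (φ.symm y))) (stdBasis i)) •
        volPullback (baseProj m n F) := by
  ext v
  have h1 : formInChart φ (fun p => (β p).compContinuousLinearMap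
      (mfderiv 𝓘(ℝ, Adap m n × F) (𝓡 m) (fun p => π (proj p)) p)) y v =
      (β (φ.symm y)) fun i => c.Dfsymm (π (proj (φ.symm y))) (v i).1.1 := by
    change β (φ.symm y) (fun i => mfderiv 𝓘(ℝ, Adap m n × F) (𝓡 m) (fun p => π (proj p)) (φ.symm y)
      (mfderiv 𝓘(ℝ, Adap m n × F) 𝓘(ℝ, Adap m n × F) φ.symm y (v i))) = _
    exact congrArg _ (funext fun i => h.mfderiv_base hy (v i))
  rw [h1]
  exact DFunLike.congr_fun (eq_smul_stdVol ((β (φ.symm y)).compContinuousLinearMap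
    (c.Dfsymm (π (proj (φ.symm y)))))) fun i => (v i).1.1

end IsNaturalChart

end Charts

/-! ### Local densities, and the Lagrangian equations in coordinates -/

section LocalForms

variable {M E : Type*} [TopologicalSpace M] [TopologicalSpace E] {m n : ℕ}
  [ChartedSpace (Rn m) M] [ChartedSpace (Rn (m + n)) E] {π : E → M}

/-- The function `ρ` such that `η = ρ dᵐx`. -/
def localVol (c : AdaptedChart m n π) (η : ∀ x : M, TangentSpace (𝓡 m) x [⋀^Fin m]→L[ℝ] ℝ)
    (y : Rn m) : ℝ :=
  η (c.f.symm y) fun i => mfderiv 𝓘(ℝ, Rn m) (𝓡 m) c.f.symm y (stdBasis i)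

/-- The tangent spaces at equal points are the same model space by definition, so the values can be
compared without transporting the vectors. -/
theorem form_apply_congr {k : ℕ} (η : ∀ x : M, TangentSpace (𝓡 m) x [⋀^Fin k]→L[ℝ] ℝ) {x x' : M}
    (h : x' = x) (w : Fin k → Rn m) :
    (η x' : Rn m [⋀^Fin k]→L[ℝ] ℝ) w = (η x : Rn m [⋀^Fin k]→L[ℝ] ℝ) w := by
  subst h; rfl

theorem localVol_f (c : AdaptedChart m n π) (η : ∀ x : M, TangentSpace (𝓡 m) x [⋀^Fin m]→L[ℝ] ℝ)
    {x : M} (hx : x ∈ c.f.source) :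
    localVol c η (c.f x) = η x fun i => c.Dfsymm x (stdBasis i) :=
  form_apply_congr η (c.f.left_inv hx) _

/-- The smoothness of `η` is given in the preferred charts of `M`, while `ρ` refers to the base
chart of an adapted chart. The change of coordinates multiplies the density by the Jacobian
determinant of the transition map, which is smooth. -/
theorem differentiableAt_localVol [IsManifold (𝓡 m) ∞ M] (c : AdaptedChart m n π)
    {η : ∀ x : M, TangentSpace (𝓡 m) x [⋀^Fin m]→L[ℝ] ℝ} (hη : IsVolumeForm η)
    {y : Rn m} (hy : y ∈ c.f.target) : DifferentiableAt ℝ (localVol c η) y := by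
  set κ := chartAt (Rn m) (c.f.symm y) with hκ
  have : IsManifold (𝓡 m) 1 M := IsManifold.of_le (n := ∞) (by simp)
  have hκd : κ.MDifferentiable (𝓡 m) (𝓡 m) := mdifferentiable_chart _
  set s := (c.f.symm.trans κ).source with hs
  have hso : IsOpen s := (c.f.symm.trans κ).open_source
  have hys : y ∈ s := by
    simp [hs, hy, hκ]
  have hmem : ∀ y' ∈ s, y' ∈ c.f.target ∧ c.f.symm y' ∈ κ.source := fun y' hy' => by
    simpa [hs] using hy'
  have ht : ContDiffOn ℝ ∞ (κ ∘ c.f.symm) s := by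
    rw [← contMDiffOn_iff_contDiffOn]
    exact (contMDiffOn_chart (I := 𝓡 m) (n := ∞)).comp
      (c.contMDiffOn_f_symm.mono fun y' hy' => (hmem y' hy').1) fun y' hy' => (hmem y' hy').2
  -- The second factor is the Jacobian determinant of `κ ∘ c.f.symm`, written as the volume of the
  -- image of the standard frame.
  have hloc : ∀ y' ∈ s, localVol c η y' =
      formInChart κ η (κ (c.f.symm y')) stdBasis *
        stdVol m (fun i => fderiv ℝ (κ ∘ c.f.symm) y' (stdBasis i)) := by
    intro y' hy'
    obtain ⟨h1, h2⟩ := hmem y' hy'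
    have e1 := DFunLike.congr_fun (eq_smul_stdVol (formInChart κ η (κ (c.f.symm y'))))
      (fun i => fderiv ℝ (κ ∘ c.f.symm) y' (stdBasis i))
    refine Eq.trans ?_ e1
    have e2 : ∀ v, mfderiv (𝓡 m) (𝓡 m) κ.symm (κ (c.f.symm y')) (fderiv ℝ (κ ∘ c.f.symm) y' v) =
        mfderiv 𝓘(ℝ, Rn m) (𝓡 m) c.f.symm y' v := by
      intro v
      have e3 := mfderiv_comp (I := 𝓘(ℝ, Rn m)) (I' := 𝓡 m) (I'' := 𝓡 m) y' (g := κ)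
        (f := c.f.symm) (hκd.mdifferentiableAt h2) (c.mdiff_f.mdifferentiableAt_symm h1)
      rw [mfderiv_eq_fderiv] at e3
      rw [e3]
      exact DFunLike.congr_fun (hκd.symm_comp_deriv h2) _
    change _ = η (κ.symm (κ (c.f.symm y'))) (fun i =>
      mfderiv (𝓡 m) (𝓡 m) κ.symm (κ (c.f.symm y')) (fderiv ℝ (κ ∘ c.f.symm) y' (stdBasis i)))
    simp only [e2]
    exact (form_apply_congr η (κ.left_inv h2) _).symm
  have hd : DifferentiableAt ℝ (fun y' => formInChart κ η (κ (c.f.symm y')) stdBasis *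
      stdVol m (fun i => fderiv ℝ (κ ∘ c.f.symm) y' (stdBasis i))) y := by
    refine DifferentiableAt.mul ?_ ?_
    · have h1 : DifferentiableAt ℝ (formInChart κ η) ((κ ∘ c.f.symm) y) :=
        ((hη.smooth _).differentiableOn (by simp)).differentiableAt
          (κ.open_target.mem_nhds (κ.map_source (hmem y hys).2))
      have h2 : DifferentiableAt ℝ (κ ∘ c.f.symm) y :=
        (ht.differentiableOn (by simp)).differentiableAt (hso.mem_nhds hys)
      have h3 : DifferentiableAt ℝ (fun y' => formInChart κ η ((κ ∘ c.f.symm) y')) y :=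
        DifferentiableAt.comp y h1 h2
      exact (ContinuousAlternatingMap.apply ℝ (Rn m) ℝ (stdBasis : Fin m → Rn m)).differentiableAt.comp y h3
    · have h1 : DifferentiableAt ℝ (fun y' => fderiv ℝ (κ ∘ c.f.symm) y') y :=
        (((ht.fderiv_of_isOpen hso (m := ∞) (by simp))).differentiableOn (by simp)).differentiableAt
          (hso.mem_nhds hys)
      refine ((Mom.contDiff_stdVol m).differentiable (by simp)).differentiableAt.comp y ?_
      rw [differentiableAt_pi]
      exact fun i => h1.clm_apply (differentiableAt_const _)
  refine hd.congr_of_eventuallyEq ?_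
  filter_upwards [hso.mem_nhds hys] with y' hy' using hloc y' hy'

variable [IsFibration m n π]

theorem Jet1.isNaturalChart (z : Jet1 m n π) :
    IsNaturalChart (adaptedAt m n π z.pt) (Jet.pt : Jet1 m n π → E) (chartAt (JetModel m n) z) :=
  have : IsManifold 𝓘(ℝ, JetModel m n) 1 (Jet1 m n π) := IsManifold.of_le (n := ∞) (by simp)
  ⟨mdifferentiable_chart z, (Jet1.natBundle m n π).contMDiff_proj.mdifferentiable (by simp),
    fun _ hp => hp, fun _ _ => rfl⟩

theorem Mom.isNaturalChart (β : Mom m n π) :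
    IsNaturalChart (adaptedAt m n π β.pt) (Mom.pt : Mom m n π → E) (chartAt (MomModel m n) β) :=
  have : IsManifold 𝓘(ℝ, MomModel m n) 1 (Mom m n π) := IsManifold.of_le (n := ∞) (by simp)
  ⟨mdifferentiable_chart β, (Mom.natBundle m n π).contMDiff_proj.mdifferentiable (by simp),
    fun _ hp => hp, fun _ _ => rfl⟩

/-- The local Lagrangian `ℓ` in the natural chart at `z`, such that `𝓛 = ℓ dᵐx`. -/
def localLag (η : ∀ x : M, TangentSpace (𝓡 m) x [⋀^Fin m]→L[ℝ] ℝ) (L : Jet1 m n π → ℝ)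
    (z : Jet1 m n π) (y : JetModel m n) : ℝ :=
  L ((chartAt (JetModel m n) z).symm y) * localVol (adaptedAt m n π z.pt) η y.1.1

theorem base_mem_target (z : Jet1 m n π) {y : JetModel m n}
    (hy : y ∈ (chartAt (JetModel m n) z).target) : y.1.1 ∈ (adaptedAt m n π z.pt).f.target := by
  rw [← z.isNaturalChart.f_proj_symm hy]
  exact (adaptedAt m n π z.pt).f.map_source ((adaptedAt m n π z.pt).mapsTo _
    (z.isNaturalChart.mapsTo _ ((chartAt (JetModel m n) z).map_target hy)))

theorem formInChart_lagForm (η : ∀ x : M, TangentSpace (𝓡 m) x [⋀^Fin m]→L[ℝ] ℝ)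
    (L : Jet1 m n π → ℝ) (z : Jet1 m n π) {y : JetModel m n}
    (hy : y ∈ (chartAt (JetModel m n) z).target) :
    formInChart (chartAt (JetModel m n) z) (lagForm η L) y =
      localLag η L z y • volPullback (baseProj m n _) := by
  have hz := z.isNaturalChart
  refine (hz.formInChart_base (lagDensity η L) hy).trans ?_
  congr 1
  rw [localLag, ← hz.f_proj_symm hy, localVol_f _ _ ((adaptedAt m n π z.pt).mapsTo _
    (hz.mapsTo _ ((chartAt (JetModel m n) z).map_target hy)))]
  rfl

theorem differentiableAt_localLag [IsManifold (𝓡 m) ∞ M]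
    {η : ∀ x : M, TangentSpace (𝓡 m) x [⋀^Fin m]→L[ℝ] ℝ} (hη : IsVolumeForm η)
    {L : Jet1 m n π → ℝ} (hL : ContMDiff 𝓘(ℝ, JetModel m n) 𝓘(ℝ, ℝ) ∞ L) (z : Jet1 m n π)
    {y : JetModel m n} (hy : y ∈ (chartAt (JetModel m n) z).target) :
    DifferentiableAt ℝ (localLag η L z) y := by
  have h1 : DifferentiableAt ℝ (fun y => L ((chartAt (JetModel m n) z).symm y)) y := by
    rw [← mdifferentiableAt_iff_differentiableAt]
    exact (hL.mdifferentiableAt (by simp)).comp y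
      (z.isNaturalChart.mdifferentiable.mdifferentiableAt_symm hy)
  have h2 : DifferentiableAt ℝ (fun y : JetModel m n =>
      localVol (adaptedAt m n π z.pt) η y.1.1) y :=
    (differentiableAt_localVol _ hη (base_mem_target z hy)).comp y
      (differentiableAt_fst.comp y differentiableAt_fst)
  exact h1.mul h2

/-- The exterior derivative depends only on the germ of the local expression at the point, so a
semibasic form `g dᵐx` contributes `dg ∧ dᵐx`. -/
theorem extD_eq_wedge {F P : Type*} [NormedAddCommGroup F] [NormedSpace ℝ F] [TopologicalSpace P]
    [ChartedSpace (Adap m n × F) P]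
    {β : ∀ p : P, TangentSpace 𝓘(ℝ, Adap m n × F) p [⋀^Fin m]→L[ℝ] ℝ} {p : P}
    {g : Adap m n × F → ℝ}
    (hg : DifferentiableAt ℝ g (chartAt (Adap m n × F) p p))
    (h : ∀ y ∈ (chartAt (Adap m n × F) p).target,
      formInChart (chartAt (Adap m n × F) p) β y = g y • volPullback (baseProj m n F)) :
    extD β p = wedge (fderiv ℝ g (chartAt (Adap m n × F) p p))
      (volPullback (baseProj m n F)) := by
  rw [← extDeriv_smul_const hg, extD]
  apply Filter.EventuallyEq.extDeriv_eq
  filter_upwards [(chartAt (Adap m n × F) p).open_target.mem_nhds (mem_chart_target _ p)]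
    with y hy using h y hy

/-- The form `A_π^η(j)` lies over `j¹ν(j)` and `d𝓛(z)` lies over `z`, which forces `z = j¹ν(j)`.
What remains is an equality of two forms `α ∧ dᵐx`, tested on vertical vectors. -/
theorem mem_lagSubmanifold_iff [IsManifold (𝓡 m) ∞ M]
    {η : ∀ x : M, TangentSpace (𝓡 m) x [⋀^Fin m]→L[ℝ] ℝ} (hη : IsVolumeForm η)
    {L : Jet1 m n π → ℝ} (hL : ContMDiff 𝓘(ℝ, JetModel m n) 𝓘(ℝ, ℝ) ∞ L) (j : JetMom m n π) :
    j ∈ lagSubmanifold η L ↔ ∀ k : JetModel m n, k.1.1 = 0 →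
      tulCovector j k = fderiv ℝ (localLag η L (jetProj j))
        (chartAt (JetModel m n) (jetProj j) (jetProj j)) k := by
  -- Any splitting of the base projection serves here; the constant one `w ↦ (w, 0, 0)` is taken.
  have hγ : ∀ w : Rn m, baseProj m n (Rn m →L[ℝ] Rn n) (((ContinuousLinearMap.inl ℝ (Adap m n)
      (Rn m →L[ℝ] Rn n)).comp (ContinuousLinearMap.inl ℝ (Rn m) (Rn n))) w) = w := fun w => rfl
  refine Iff.trans ?_ (wedge_volPullback_eq_iff hγ)
  have key := extD_eq_wedge (p := jetProj j)
    (differentiableAt_localLag hη hL (jetProj j) (mem_chart_target _ _))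
    fun y hy => formInChart_lagForm η L (jetProj j) hy
  constructor
  · rintro ⟨z, hz⟩
    obtain rfl : z = jetProj j := congrArg Sigma.fst hz
    have h2 := eq_of_heq (Sigma.mk.inj hz).2
    exact (h2.symm.trans key)
  · intro h
    refine ⟨jetProj j, ?_⟩
    exact congrArg (Sigma.mk (jetProj j)) (key.trans h.symm)

/-! ### The Hamiltonian side -/

theorem derivAction_neg {V : Type*} [NormedAddCommGroup V] [NormedSpace ℝ V] {k : ℕ}
    (T : V →L[ℝ] V) (β : V [⋀^Fin k]→L[ℝ] ℝ) : derivAction T (-β) = -derivAction T β := by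
  ext v
  rw [ContinuousAlternatingMap.neg_apply, derivAction_apply, derivAction_apply,
    ← Finset.sum_neg_distrib]
  rfl

theorem Mom.coordForm_coordAt {c : AdaptedChart m n π} (β : Mom m n π) (hβ : β.pt ∈ c.e.source) :
    coordForm (Mom.coordAt c β.pt β.form) = β.form.1.compContinuousLinearMap (c.Dsymm β.pt) :=
  coordForm_formCoord (Mom.compDsymm_mem hβ β.form.2)

theorem Mom.coordAt_symm (β : Mom m n π) {y : MomModel m n}
    (hy : y ∈ (chartAt (MomModel m n) β).target) :
    Mom.coordAt (adaptedAt m n π β.pt) ((chartAt (MomModel m n) β).symm y).pt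
      ((chartAt (MomModel m n) β).symm y).form = y.2 :=
  congrArg Prod.snd ((chartAt (MomModel m n) β).right_inv hy)

/-- The coefficients of `Θ` in a natural chart are the fibre coordinates themselves, which is the
tautological property. -/
theorem formInChart_tautForm (β : Mom m n π) {y : MomModel m n}
    (hy : y ∈ (chartAt (MomModel m n) β).target) :
    formInChart (chartAt (MomModel m n) β) tautForm y =
      (coordForm y.2).compContinuousLinearMap (ContinuousLinearMap.fst ℝ _ _) := by
  have hβ := β.isNaturalChart
  ext v
  have h1 : formInChart (chartAt (MomModel m n) β) tautForm y v =
      ((chartAt (MomModel m n) β).symm y).form.1 (fun i => (adaptedAt m n π β.pt).Dsymm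
        ((chartAt (MomModel m n) β).symm y).pt (v i).1) :=
    congrArg _ (funext fun i => hβ.mfderiv_proj hy (v i))
  rw [h1, ← β.coordAt_symm hy, Mom.coordForm_coordAt _
    (hβ.mapsTo _ ((chartAt (MomModel m n) β).map_target hy))]
  rfl

/-- The local expression of `Θ` is a continuous linear function of the point, so it is its own
derivative, and the alternatization is the same form at every `β`. -/
theorem extD_tautForm (β : Mom m n π) : extD tautForm β = localdTaut m n := by
  have h : formInChart (chartAt (MomModel m n) β) tautForm =ᶠ[𝓝 (chartAt (MomModel m n) β β)]
      ((ContinuousAlternatingMap.compContinuousLinearMapCLM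
      (ContinuousLinearMap.fst ℝ (Adap m n) (ℝ × (Fin m → Fin n → ℝ)))).comp
      (coordFormL.comp (ContinuousLinearMap.snd ℝ (Adap m n) (ℝ × (Fin m → Fin n → ℝ))))) := by
    filter_upwards [(chartAt (MomModel m n) β).open_target.mem_nhds (mem_chart_target _ β)]
      with y hy using formInChart_tautForm β hy
  rw [extD, h.extDeriv_eq, extDeriv, ContinuousLinearMap.fderiv]
  rfl

/-- The images of the coordinate vectors `∂/∂xⁱ` under a jet of `π ∘ ν`. -/
def jetFrame (j : JetMom m n π) : Rn m →L[ℝ] MomModel m n :=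
  ContinuousLinearMap.comp (σ₁₂ := RingHom.id ℝ) (σ₂₃ := RingHom.id ℝ) (M₂ := Rn m) j.map
    ((adaptedAt m n π j.pt.pt).Dfsymm (π j.pt.pt))

theorem mfderiv_base_mom (β : Mom m n π) (v : MomModel m n) :
    mfderiv 𝓘(ℝ, MomModel m n) (𝓡 m) (fun β : Mom m n π => π β.pt) β v =
      (adaptedAt m n π β.pt).Dfsymm (π β.pt) v.1.1 :=
  have : IsManifold 𝓘(ℝ, MomModel m n) 1 (Mom m n π) := IsManifold.of_le (n := ∞) (by simp)
  β.isNaturalChart.mfderiv_base_self v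

theorem mfderiv_pt_mom (β : Mom m n π) (v : MomModel m n) :
    mfderiv 𝓘(ℝ, MomModel m n) (𝓡 (m + n)) (Mom.pt : Mom m n π → E) β v =
      (adaptedAt m n π β.pt).Dsymm β.pt v.1 :=
  have : IsManifold 𝓘(ℝ, MomModel m n) 1 (Mom m n π) := IsManifold.of_le (n := ∞) (by simp)
  β.isNaturalChart.mfderiv_proj_self v

theorem mapsTo_adaptedAt (u : E) : π u ∈ (adaptedAt m n π u).f.source :=
  (adaptedAt m n π u).mapsTo u (mem_adaptedAt u)

/-- The section condition on `j`, read in coordinates: `jetFrame j` splits `baseProj`, as the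
criterion for equality of the forms `α ∧ dᵐx` requires. -/
theorem jetFrame_fst_fst (j : JetMom m n π) (w : Rn m) : (jetFrame j w).1.1 = w := by
  have h1 := DFunLike.congr_fun j.isSection ((adaptedAt m n π j.pt.pt).Dfsymm (π j.pt.pt) w)
  have h2 := (mfderiv_base_mom j.pt (jetFrame j w)).symm.trans h1
  have h3 := congrArg ((adaptedAt m n π j.pt.pt).Df (π j.pt.pt)) h2
  rw [AdaptedChart.Df_Dfsymm (mapsTo_adaptedAt _)] at h3
  exact h3.trans (AdaptedChart.Df_Dfsymm (mapsTo_adaptedAt _) w)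

/-- In the chart at `j.pt` the horizontal projector is `jetFrame j` composed with the base
projection, and `Ω` is `-localdTaut`. The coordinate formula for `dΘ` then applies, with the sign
reversed. -/
theorem flatMap_eq (j : JetMom m n π) :
    flatMap j = ⟨j.pt, (-wedge (hamCovector (jetFrame j)) (volPullback (baseProj m n _)) :
      MomModel m n [⋀^Fin (m + 1)]→L[ℝ] ℝ)⟩ := by
  rw [← derivAction_localdTaut (jetFrame_fst_fst j)]
  refine congrArg (Sigma.mk j.pt) ?_
  have h1 : (j.map.comp (mfderiv 𝓘(ℝ, MomModel m n) (𝓡 m) (fun β : Mom m n π => π β.pt) j.pt)) =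
      (jetFrame j).comp (baseProj m n _) := by
    ext1 v
    exact congrArg j.map (mfderiv_base_mom j.pt v)
  have h2 : canForm j.pt = -localdTaut m n := congrArg Neg.neg (extD_tautForm j.pt)
  rw [h1, h2]
  refine (congrArg₂ HSub.hSub (derivAction_neg (V := MomModel m n) _ (localdTaut m n))
    (smul_neg ((m : ℝ) - 1) (localdTaut m n))).trans ?_
  abel

/-- The velocities `uᵅᵢ` of `j¹ν(j)` are those of `j` itself, read off its frame. -/
theorem jetProj_fib (j : JetMom m n π) (w : Rn m) :
    (chartAt (JetModel m n) (jetProj j) (jetProj j)).2 w = (jetFrame j w).1.2 := by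
  have h := mfderiv_pt_mom j.pt (jetFrame j w)
  have h2 := congrArg (fun v => ((adaptedAt m n π j.pt.pt).D j.pt.pt v).2) h
  simp only [AdaptedChart.D_Dsymm (mem_adaptedAt _)] at h2
  exact h2

theorem tulCovector_apply (j : JetMom m n π) (k : JetModel m n) :
    tulCovector j k = ∑ a, (∑ i, (jetFrame j (stdBasis i)).2.2 i a) * k.1.2 a +
      ∑ i, ∑ a, momCoord j.pt i a * k.2 (stdBasis i) a := by
  simp [tulCovector, momVel, jetFrame]
  rfl

end LocalForms

/-! ### The Legendre transform in coordinates -/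

section Legendre

variable {M E : Type*} [TopologicalSpace M] [TopologicalSpace E] {m n : ℕ}
  [ChartedSpace (Rn m) M] [ChartedSpace (Rn (m + n)) E] {π : E → M} [IsFibration m n π]

/-- The natural chart at a jet is built from the adapted chart chosen at its base point. The jets
`leg_𝓛⁻¹(μ(ω))` and `j¹ν(j)` lie over the same point of `E`, so they can be compared in one chart
even before they are known to be equal. -/
theorem Jet1.chartAt_eq {z z' : Jet1 m n π} (h : z.pt = z'.pt) :
    chartAt (JetModel m n) z = chartAt (JetModel m n) z' := by
  obtain ⟨u, a, ha⟩ := z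
  obtain ⟨u', a', ha'⟩ := z'
  obtain rfl : u = u' := h
  rfl

theorem localLag_eq (η : ∀ x : M, TangentSpace (𝓡 m) x [⋀^Fin m]→L[ℝ] ℝ)
    (L : Jet1 m n π → ℝ) {z z' : Jet1 m n π} (h : z.pt = z'.pt) :
    localLag η L z = localLag η L z' := by
  obtain ⟨u, a, ha⟩ := z
  obtain ⟨u', a', ha'⟩ := z'
  obtain rfl : u = u' := h
  rfl

theorem clm_eq_sum (A : Rn m →L[ℝ] Rn n) :
    A = ∑ i, ∑ a, A (stdBasis i) a •
      (EuclideanSpace.proj i : Rn m →L[ℝ] ℝ).smulRight (stdBasis a : Rn n) := by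
  have hA : ∀ w, A w = ∑ i, w i • A (stdBasis i) := by
    intro w
    have h : w = ∑ i, w i • (stdBasis i : Rn m) := by
      ext l; simp [stdBasis, Finset.sum_apply, Pi.single_apply]
    conv_lhs => rw [h]
    simp
  ext w b
  rw [hA w]
  simp [Pi.single_apply, mul_comm]

theorem sum_mul_smulRight (C : Fin m → Fin n → ℝ) (i : Fin m) (a : Fin n) :
    ∑ k, ∑ b, C k b * ((EuclideanSpace.proj i : Rn m →L[ℝ] ℝ).smulRight
      (stdBasis a : Rn n)) (stdBasis k) b = C i a := by
  rw [Finset.sum_eq_single i, Finset.sum_eq_single a]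
  · simp
  · intro b _ hb
    simp [hb]
  · simp
  · intro k _ hk
    simp [hk.symm]
  · simp

/-- The factor `ρ` in `ℓ = ρ L` depends only on the base point, so it is constant along the fibres
of `J¹π → E`. -/
theorem fderiv_localLag_vertical [IsManifold (𝓡 m) ∞ M]
    {η : ∀ x : M, TangentSpace (𝓡 m) x [⋀^Fin m]→L[ℝ] ℝ} (hη : IsVolumeForm η)
    {L : Jet1 m n π → ℝ} (hL : ContMDiff 𝓘(ℝ, JetModel m n) 𝓘(ℝ, ℝ) ∞ L) (z : Jet1 m n π)
    (A : Rn m →L[ℝ] Rn n) :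
    fderiv ℝ (localLag η L z) (chartAt (JetModel m n) z z) (0, A) =
      fderiv ℝ (L ∘ (chartAt (JetModel m n) z).symm) (chartAt (JetModel m n) z z) (0, A) *
        η (π z.pt) (fun i => (adaptedAt m n π z.pt).Dfsymm (π z.pt) (stdBasis i)) := by
  have hz := z.isNaturalChart
  have hy : chartAt (JetModel m n) z z ∈ (chartAt (JetModel m n) z).target := mem_chart_target _ z
  have h1 : DifferentiableAt ℝ (L ∘ (chartAt (JetModel m n) z).symm)
      (chartAt (JetModel m n) z z) := by
    rw [← mdifferentiableAt_iff_differentiableAt]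
    exact (hL.mdifferentiableAt (by simp)).comp _ (hz.mdifferentiable.mdifferentiableAt_symm hy)
  have h2 : HasFDerivAt (fun y : JetModel m n => localVol (adaptedAt m n π z.pt) η y.1.1)
      ((fderiv ℝ (localVol (adaptedAt m n π z.pt) η) (chartAt (JetModel m n) z z).1.1).comp
        (baseProj m n _)) (chartAt (JetModel m n) z z) :=
    HasFDerivAt.comp (g := localVol (adaptedAt m n π z.pt) η) (chartAt (JetModel m n) z z)
      (differentiableAt_localVol _ hη (base_mem_target z hy)).hasFDerivAt
      (baseProj m n (Rn m →L[ℝ] Rn n)).hasFDerivAt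
  have h3 := (h1.hasFDerivAt.mul h2).fderiv
  have h4 : (chartAt (JetModel m n) z z).1.1 = (adaptedAt m n π z.pt).f (π z.pt) :=
    (adaptedAt m n π z.pt).fst_e _ (mem_adaptedAt _)
  have h5 : localLag η L z = (L ∘ (chartAt (JetModel m n) z).symm) *
      fun y : JetModel m n => localVol (adaptedAt m n π z.pt) η y.1.1 := rfl
  rw [h5, h3, h4,
    localVol_f _ _ (mapsTo_adaptedAt _)]
  simp [mul_comm]

/-- The coordinate `pⁱ_α` is the value on the frame whose `i`-th vector is replaced by `∂/∂uᵅ`. This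
vector is vertical, so `L η` contributes nothing, and in the derivation only the `i`-th term
survives. There the contact form is the identity on `∂/∂uᵅ`, the endomorphism produces the lift of
`∑ₖ ∂L/∂uᵅₖ ∂/∂xᵏ`, and the volume form selects `k = i`. -/
theorem Mom.coordAt_legForm (η : ∀ x : M, TangentSpace (𝓡 m) x [⋀^Fin m]→L[ℝ] ℝ)
    (L : Jet1 m n π → ℝ) (z : Jet1 m n π) (i : Fin m) (a : Fin n) :
    (Mom.coordAt (adaptedAt m n π z.pt) z.pt (legForm η L z)).2 i a =
      vertDeriv L z i (stdBasis a) *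
        η (π z.pt) (fun i => (adaptedAt m n π z.pt).Dfsymm (π z.pt) (stdBasis i)) := by
  set c := adaptedAt m n π z.pt with hc
  have hu : z.pt ∈ c.e.source := mem_adaptedAt _
  set v : Fin m → TangentSpace (𝓡 (m + n)) z.pt :=
    fun l => c.Dsymm z.pt (Function.update dX i (dU a) l) with hv
  have hvi : mfderiv (𝓡 (m + n)) (𝓡 m) π z.pt (v i) = 0 := by
    rw [hv, AdaptedChart.mfderiv_Dsymm hu]
    simp
  have hvl : ∀ l, l ≠ i → mfderiv (𝓡 (m + n)) (𝓡 m) π z.pt (v l) =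
      c.Dfsymm (π z.pt) (stdBasis l) := by
    intro l hl
    rw [hv, AdaptedChart.mfderiv_Dsymm hu]
    simp [Function.update_of_ne hl]
  have hcon : contact z (v i) = c.Dsymm z.pt (dU a) := by
    change v i - z.map (mfderiv (𝓡 (m + n)) (𝓡 m) π z.pt (v i)) = _
    rw [hvi, map_zero, sub_zero]
    simp [hv]
  have hend : vertEndo L z (v i) =
      c.Dfsymm (π z.pt) (∑ k, vertDeriv L z k (stdBasis a) • stdBasis k) := by
    have h1 : vertEndo L z (v i) = ∑ k, vertDeriv L z k ((c.D z.pt (contact z (v i))).2) •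
        c.Dfsymm (π z.pt) (stdBasis k) := by
      simp only [vertEndo, _root_.sum_apply]
      rfl
    rw [h1, hcon, AdaptedChart.D_Dsymm hu]
    simp
  have hsec : ∀ w, mfderiv (𝓡 (m + n)) (𝓡 m) π z.pt (z.map w) = w :=
    fun w => DFunLike.congr_fun z.isSection w
  change L z * η (π z.pt) (fun l => mfderiv (𝓡 (m + n)) (𝓡 m) π z.pt (v l)) + ∑ k, η (π z.pt)
    (fun l => mfderiv (𝓡 (m + n)) (𝓡 m) π z.pt
      (Function.update v k (z.map (vertEndo L z (v k))) l)) = _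
  rw [(η (π z.pt)).map_coord_zero i hvi, mul_zero, zero_add, Finset.sum_eq_single i]
  · have h1 : (fun l => mfderiv (𝓡 (m + n)) (𝓡 m) π z.pt
        (Function.update v i (z.map (vertEndo L z (v i))) l)) =
        fun l => c.Dfsymm (π z.pt) (Function.update stdBasis i
          (∑ k, vertDeriv L z k (stdBasis a) • stdBasis k) l) := by
      ext1 l
      rcases eq_or_ne l i with rfl | hl
      · rw [Function.update_self, Function.update_self, hsec, hend]
      · rw [Function.update_of_ne hl, Function.update_of_ne hl, hvl l hl]
    have h2 := DFunLike.congr_fun (eq_smul_stdVol ((η (π z.pt)).compContinuousLinearMap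
      (c.Dfsymm (π z.pt)))) (Function.update stdBasis i
          (∑ k, vertDeriv L z k (stdBasis a) • stdBasis k))
    rw [h1]
    refine h2.trans ?_
    rw [ContinuousAlternatingMap.smul_apply, stdVol_update, smul_eq_mul, mul_comm]
    congr 1
    simp [Pi.single_apply]
  · intro k _ hk
    exact (η (π z.pt)).map_coord_zero i (by rw [Function.update_of_ne hk.symm, hvi])
  · simp

/-- The coordinates `pⁱ_α = ∂ℓ/∂uᵅᵢ` of the Legendre transform. -/
theorem fderiv_localLag_eq_sum [IsManifold (𝓡 m) ∞ M]
    {η : ∀ x : M, TangentSpace (𝓡 m) x [⋀^Fin m]→L[ℝ] ℝ} (hη : IsVolumeForm η)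
    {L : Jet1 m n π → ℝ} (hL : ContMDiff 𝓘(ℝ, JetModel m n) 𝓘(ℝ, ℝ) ∞ L) (z : Jet1 m n π)
    (A : Rn m →L[ℝ] Rn n) :
    fderiv ℝ (localLag η L z) (chartAt (JetModel m n) z z) (0, A) =
      ∑ i, ∑ a, RedMom.fib (adaptedAt m n π z.pt) (leg η L z) i a * A (stdBasis i) a := by
  have h1 : RedMom.fib (adaptedAt m n π z.pt) (leg η L z) =
      (Mom.coordAt (adaptedAt m n π z.pt) z.pt (legForm η L z)).2 :=
    RedMom.fib_toRed (β := Leg η L z) (mem_adaptedAt z.pt)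
  set d := fderiv ℝ (localLag η L z) (chartAt (JetModel m n) z z) with hd
  have h2 : ∀ B : Rn m →L[ℝ] Rn n,
      d (0, B) = d.comp (ContinuousLinearMap.inr ℝ (Adap m n) (Rn m →L[ℝ] Rn n)) B := fun B => rfl
  rw [h2]
  -- By linearity it is enough to treat the elementary maps `dxⁱ ⊗ ∂/∂uᵅ`, which are the directions
  -- used in `vertDeriv`.
  conv_lhs => rw [clm_eq_sum A]
  simp only [map_sum, map_smul, smul_eq_mul, h1, Mom.coordAt_legForm]
  refine Finset.sum_congr rfl fun i _ => Finset.sum_congr rfl fun a _ => ?_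
  rw [← h2, hd, fderiv_localLag_vertical hη hL,
    ← mfderiv_eq_fderiv_chartAt (hL.mdifferentiableAt (by simp)), mul_comm]
  rfl

/-! ### The local Hamiltonian -/

/-- The lift of `∂/∂xⁱ` by the jet is `∂/∂xⁱ + uᵅᵢ ∂/∂uᵅ`. Evaluating `ω` on these lifts with
`coordForm_graph` gives the coefficient `p + pⁱ_α uᵅᵢ` of `⟨ω, z⟩ η`. -/
theorem Mom.pullback_apply {c : AdaptedChart m n π} (β : Mom m n π) (hβ : β.pt ∈ c.e.source)
    (z : Jet1 m n π) (h : z.pt = β.pt) :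
    β.pullback z h (fun i => c.Dfsymm (π β.pt) (stdBasis i)) =
      (Mom.coordAt c β.pt β.form).1 + ∑ i, ∑ a, (Mom.coordAt c β.pt β.form).2 i a *
        Jet1.fib c z (stdBasis i) a := by
  have hform := Mom.coordForm_coordAt β hβ
  obtain ⟨u, ξ, hξ⟩ := β
  obtain ⟨u', map, sec⟩ := z
  obtain rfl : u' = u := h
  rw [← coordForm_graph, hform]
  change ξ (fun i => map (c.Dfsymm (π u') (stdBasis i))) = ξ (fun i => c.Dsymm u' _)
  congr 1
  ext1 i
  rw [← AdaptedChart.Dsymm_D hβ (map (c.Dfsymm (π u') (stdBasis i)))]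
  congr 1
  refine Prod.ext ?_ rfl
  rw [AdaptedChart.fst_D hβ]
  refine (congrArg (c.Df (π u')) (DFunLike.congr_fun sec _)).trans ?_
  exact AdaptedChart.Df_Dfsymm (c.mapsTo _ hβ) _

variable {η : ∀ x : M, TangentSpace (𝓡 m) x [⋀^Fin m]→L[ℝ] ℝ} {L : Jet1 m n π → ℝ}

theorem IsHyperregular.legInv_leg (h : IsHyperregular η L) (z : Jet1 m n π) :
    h.legInv (leg η L z) = z := by
  rw [← h.choose_spec]
  exact h.choose.symm_apply_apply z

/-- The local expression of the inverse Legendre transform `𝓜π → J¹π` in the natural charts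
at `j`. -/
def localLegInv (h : IsHyperregular η L) (j : JetMom m n π) (y : MomModel m n) : JetModel m n :=
  chartAt (JetModel m n) (jetProj j) (h.legInv
    ((chartAt (Adap m n × (Fin m → Fin n → ℝ)) j.pt.toRed).symm (y.1, y.2.2)))

/-- The local Hamiltonian `H = p + pⁱ_α uᵅᵢ - ℓ`, such that `𝓗 = H dᵐx`. -/
def localHam (h : IsHyperregular η L) (j : JetMom m n π) (y : MomModel m n) : ℝ :=
  y.2.1 + ∑ i, ∑ a, y.2.2 i a * (localLegInv h j y).2 (stdBasis i) a -
    localLag η L (jetProj j) (localLegInv h j y)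

/-- In natural charts the projection `μ` forgets the coordinate `p`. -/
theorem RedMom.symm_chartAt (j : JetMom m n π) {y : MomModel m n}
    (hy : y ∈ (chartAt (MomModel m n) j.pt).target) :
    (chartAt (Adap m n × (Fin m → Fin n → ℝ)) j.pt.toRed).symm (y.1, y.2.2) =
      ((chartAt (MomModel m n) j.pt).symm y).toRed := by
  set β := (chartAt (MomModel m n) j.pt).symm y with hβ
  have hsrc : β.pt ∈ (adaptedAt m n π j.pt.pt).e.source :=
    (chartAt (MomModel m n) j.pt).map_target hy
  have h1 : (y.1, y.2.2) =
      chartAt (Adap m n × (Fin m → Fin n → ℝ)) j.pt.toRed β.toRed := by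
    refine Prod.ext ?_ ?_
    · exact (j.pt.isNaturalChart.fst_eq hy).symm
    · refine Eq.trans ?_ (RedMom.fib_toRed hsrc).symm
      rw [j.pt.coordAt_symm hy]
  rw [h1]
  exact (chartAt (Adap m n × (Fin m → Fin n → ℝ)) j.pt.toRed).left_inv hsrc

theorem localLegInv_eq (h : IsHyperregular η L) (j : JetMom m n π) {y : MomModel m n}
    (hy : y ∈ (chartAt (MomModel m n) j.pt).target) :
    localLegInv h j y = chartAt (JetModel m n) (jetProj j)
      (h.legInv ((chartAt (MomModel m n) j.pt).symm y).toRed) := by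
  rw [localLegInv, RedMom.symm_chartAt j hy]

theorem localLegInv_fst (h : IsHyperregular η L) (j : JetMom m n π) {y : MomModel m n}
    (hy : y ∈ (chartAt (MomModel m n) j.pt).target) : (localLegInv h j y).1 = y.1 := by
  rw [localLegInv_eq h j hy, ← j.pt.isNaturalChart.fst_eq hy]
  exact congrArg (adaptedAt m n π j.pt.pt).e (h.legInv_pt _)

theorem legInv_mem_source (h : IsHyperregular η L) (j : JetMom m n π) {y : MomModel m n}
    (hy : y ∈ (chartAt (MomModel m n) j.pt).target) :
    h.legInv ((chartAt (MomModel m n) j.pt).symm y).toRed ∈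
      (chartAt (JetModel m n) (jetProj j)).source := by
  have hsrc : ((chartAt (MomModel m n) j.pt).symm y).pt ∈ (adaptedAt m n π j.pt.pt).e.source :=
    (chartAt (MomModel m n) j.pt).map_target hy
  rw [← h.legInv_pt ((chartAt (MomModel m n) j.pt).symm y)] at hsrc
  exact hsrc

/-- The pairing contributes `p + pⁱ_α uᵅᵢ` at the inverse Legendre transform, and the term `L η`
contributes `ℓ` there. -/
theorem formInChart_hamForm (h : IsHyperregular η L) (j : JetMom m n π) {y : MomModel m n}
    (hy : y ∈ (chartAt (MomModel m n) j.pt).target) :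
    formInChart (chartAt (MomModel m n) j.pt) (hamForm h) y =
      localHam h j y • volPullback (baseProj m n _) := by
  have hj := j.pt.isNaturalChart
  refine (hj.formInChart_base (hamDensity h) hy).trans ?_
  congr 1
  have hsrc := hj.mapsTo _ ((chartAt (MomModel m n) j.pt).map_target hy)
  rw [hamDensity, ContinuousAlternatingMap.sub_apply, Mom.pullback_apply _ hsrc,
    j.pt.coordAt_symm hy, localHam, localLag, localLegInv_fst h j hy, localLegInv_eq h j hy,
    (chartAt (JetModel m n) (jetProj j)).left_inv (legInv_mem_source h j hy),
    ← hj.f_proj_symm hy, ContinuousAlternatingMap.smul_apply, smul_eq_mul]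
  congr 2
  exact (localVol_f _ η ((adaptedAt m n π j.pt.pt).mapsTo _ hsrc)).symm

/-- Here the smoothness of the inverse of `leg_𝓛` enters, and not only its existence. -/
theorem differentiableAt_localLegInv (h : IsHyperregular η L) (j : JetMom m n π) {y : MomModel m n}
    (hy : y ∈ (chartAt (MomModel m n) j.pt).target) :
    DifferentiableAt ℝ (localLegInv h j) y := by
  have : IsManifold 𝓘(ℝ, Adap m n × (Fin m → Fin n → ℝ)) 1 (RedMom m n π) :=
    IsManifold.of_le (n := ∞) (by simp)
  have h1 : MDifferentiableAt 𝓘(ℝ, MomModel m n) 𝓘(ℝ, Adap m n × (Fin m → Fin n → ℝ))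
      (fun y : MomModel m n => ((y.1, y.2.2) : Adap m n × (Fin m → Fin n → ℝ))) y := by
    rw [mdifferentiableAt_iff_differentiableAt]
    fun_prop
  have hmem : ((y.1, y.2.2) : Adap m n × (Fin m → Fin n → ℝ)) ∈
      (chartAt (Adap m n × (Fin m → Fin n → ℝ)) j.pt.toRed).target :=
    ⟨hy.1, trivial⟩
  have h2 := (mdifferentiable_chart (I := 𝓘(ℝ, Adap m n × (Fin m → Fin n → ℝ)))
    j.pt.toRed).mdifferentiableAt_symm hmem
  have h3 : MDifferentiable 𝓘(ℝ, Adap m n × (Fin m → Fin n → ℝ)) 𝓘(ℝ, JetModel m n) h.legInv :=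
    h.choose.symm.contMDiff.mdifferentiable (by simp)
  have hsrc := legInv_mem_source h j hy
  rw [← RedMom.symm_chartAt j hy] at hsrc
  have h4 := (jetProj j).isNaturalChart.mdifferentiable.mdifferentiableAt hsrc
  rw [← mdifferentiableAt_iff_differentiableAt]
  exact h4.comp y ((h3 _).comp y (h2.comp y h1))

theorem localLegInv_mem_target (h : IsHyperregular η L) (j : JetMom m n π) {y : MomModel m n}
    (hy : y ∈ (chartAt (MomModel m n) j.pt).target) :
    localLegInv h j y ∈ (chartAt (JetModel m n) (jetProj j)).target := by
  rw [localLegInv_eq h j hy]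
  exact (chartAt (JetModel m n) (jetProj j)).map_source (legInv_mem_source h j hy)

/-- Product rule and chain rule only. The derivative of the inverse Legendre transform is left as it
stands; its fibre part cancels in `fderiv_localHam`. -/
theorem differentiableAt_localHam_and_fderiv [IsManifold (𝓡 m) ∞ M] (hη : IsVolumeForm η)
    (hL : ContMDiff 𝓘(ℝ, JetModel m n) 𝓘(ℝ, ℝ) ∞ L) (h : IsHyperregular η L) (j : JetMom m n π)
    {y : MomModel m n} (hy : y ∈ (chartAt (MomModel m n) j.pt).target) :
    DifferentiableAt ℝ (localHam h j) y ∧ ∀ k, fderiv ℝ (localHam h j) y k =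
      k.2.1 + ∑ i, ∑ a, (k.2.2 i a * (localLegInv h j y).2 (stdBasis i) a +
        y.2.2 i a * (fderiv ℝ (localLegInv h j) y k).2 (stdBasis i) a) -
      fderiv ℝ (localLag η L (jetProj j)) (localLegInv h j y) (fderiv ℝ (localLegInv h j) y k) := by
  have hG := (differentiableAt_localLegInv h j hy).hasFDerivAt
  have hl := (differentiableAt_localLag hη hL (jetProj j)
    (localLegInv_mem_target h j hy)).hasFDerivAt.comp y hG
  let P : Fin m → Fin n → MomModel m n →L[ℝ] ℝ := fun i a =>
    (ContinuousLinearMap.proj (R := ℝ) (φ := fun _ : Fin n => ℝ) a).comp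
      ((ContinuousLinearMap.proj (R := ℝ) (φ := fun _ : Fin m => Fin n → ℝ) i).comp
        ((ContinuousLinearMap.snd ℝ ℝ _).comp (ContinuousLinearMap.snd ℝ (Adap m n) _)))
  let U : Fin m → Fin n → JetModel m n →L[ℝ] ℝ := fun i a =>
    (EuclideanSpace.proj a : Rn n →L[ℝ] ℝ).comp
      ((ContinuousLinearMap.apply ℝ (Rn n) (stdBasis i : Rn m)).comp
        (ContinuousLinearMap.snd ℝ (Adap m n) (Rn m →L[ℝ] Rn n)))
  have hU : ∀ i a, HasFDerivAt (fun y => (localLegInv h j y).2 (stdBasis i) a)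
      ((U i a).comp (fderiv ℝ (localLegInv h j) y)) y :=
    fun i a => (U i a).hasFDerivAt.comp y hG
  have hP : ∀ i a, HasFDerivAt (fun y : MomModel m n => y.2.2 i a) (P i a) y :=
    fun i a => (P i a).hasFDerivAt
  have h0 : HasFDerivAt (fun y : MomModel m n => y.2.1)
      ((ContinuousLinearMap.fst ℝ ℝ _).comp (ContinuousLinearMap.snd ℝ (Adap m n) _)) y :=
    ((ContinuousLinearMap.fst ℝ ℝ (Fin m → Fin n → ℝ)).comp
      (ContinuousLinearMap.snd ℝ (Adap m n) _)).hasFDerivAt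
  have hH := (h0.add (HasFDerivAt.fun_sum (u := Finset.univ) fun i _ =>
    HasFDerivAt.fun_sum (u := Finset.univ) fun a _ => (hP i a).mul (hU i a))).sub hl
  refine ⟨hH.differentiableAt, fun k => ?_⟩
  have hk := DFunLike.congr_fun (show fderiv ℝ (localHam h j) y = _ from hH.fderiv) k
  rw [hk]
  simp only [_root_.sub_apply, _root_.add_apply,
    _root_.sum_apply, _root_.smul_apply, smul_eq_mul,
    ContinuousLinearMap.comp_apply]
  congr 2
  refine Finset.sum_congr rfl fun i _ => Finset.sum_congr rfl fun a _ => ?_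
  rw [add_comm, mul_comm (_ : ℝ) (P i a k)]
  rfl

/-- Both `μ` and `leg_𝓛⁻¹` cover the identity of `E`, so only the fibre component of the derivative
is unknown. -/
theorem fderiv_localLegInv_fst (h : IsHyperregular η L) (j : JetMom m n π) {y : MomModel m n}
    (hy : y ∈ (chartAt (MomModel m n) j.pt).target) (k : MomModel m n) :
    (fderiv ℝ (localLegInv h j) y k).1 = k.1 := by
  have h1 : HasFDerivAt (fun y => (localLegInv h j y).1)
      ((ContinuousLinearMap.fst ℝ _ _).comp (fderiv ℝ (localLegInv h j) y)) y :=
    (differentiableAt_localLegInv h j hy).hasFDerivAt.fst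
  have h2 : HasFDerivAt (fun y => (localLegInv h j y).1)
      (ContinuousLinearMap.fst ℝ (Adap m n) (ℝ × (Fin m → Fin n → ℝ))) y := by
    refine hasFDerivAt_fst.congr_of_eventuallyEq ?_
    filter_upwards [(chartAt (MomModel m n) j.pt).open_target.mem_nhds hy] with y' hy'
      using localLegInv_fst h j hy'
  exact DFunLike.congr_fun (h1.unique h2) k

/-- Both sections are fixed over `j.pt`, so the only candidate for the point of `𝓜π` is `j.pt`. The
minus signs of `Ω = -dΘ` and of `-d𝓗` cancel. -/
theorem mem_hamSubmanifold_iff [IsManifold (𝓡 m) ∞ M] (hη : IsVolumeForm η)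
    (hL : ContMDiff 𝓘(ℝ, JetModel m n) 𝓘(ℝ, ℝ) ∞ L) (h : IsHyperregular η L)
    (j : JetMom m n π) :
    j ∈ hamSubmanifold h ↔ ∀ k : MomModel m n, k.1.1 = 0 →
      hamCovector (jetFrame j) k =
        fderiv ℝ (localHam h j) (chartAt (MomModel m n) j.pt j.pt) k := by
  refine Iff.trans ?_ (wedge_volPullback_eq_iff
    (pr := baseProj m n (ℝ × (Fin m → Fin n → ℝ))) (jetFrame_fst_fst j))
  have key := extD_eq_wedge (p := j.pt) (differentiableAt_localHam_and_fderiv hη hL h j (mem_chart_target _ _)).1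
    fun y hy => formInChart_hamForm h j hy
  constructor
  · rintro ⟨β, hβ⟩
    rw [flatMap_eq] at hβ
    obtain rfl : β = j.pt := congrArg Sigma.fst hβ
    have h2 := eq_of_heq (Sigma.mk.inj hβ).2
    have h3 : -extD (hamForm h) j.pt = -wedge (fderiv ℝ (localHam h j) _) _ := congrArg Neg.neg key
    exact neg_injective (h2.symm.trans h3)
  · intro hw
    refine ⟨j.pt, ?_⟩
    rw [flatMap_eq]
    exact congrArg (Sigma.mk j.pt) (congrArg Neg.neg (key.trans hw.symm))

/-- At the point itself, the local Hamiltonian satisfies `∂H/∂pⁱ_α = uᵅᵢ` and `∂H/∂uᵅ = -∂ℓ/∂uᵅ`,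
where the right-hand sides are taken at the inverse Legendre transform. -/
theorem fderiv_localHam [IsManifold (𝓡 m) ∞ M] (hη : IsVolumeForm η)
    (hL : ContMDiff 𝓘(ℝ, JetModel m n) 𝓘(ℝ, ℝ) ∞ L) (h : IsHyperregular η L) (j : JetMom m n π)
    (k : MomModel m n) :
    fderiv ℝ (localHam h j) (chartAt (MomModel m n) j.pt j.pt) k =
      k.2.1 + ∑ i, ∑ a, k.2.2 i a *
        (localLegInv h j (chartAt (MomModel m n) j.pt j.pt)).2 (stdBasis i) a -
      fderiv ℝ (localLag η L (jetProj j)) (localLegInv h j (chartAt (MomModel m n) j.pt j.pt))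
        (k.1, 0) := by
  set y := chartAt (MomModel m n) j.pt j.pt with hyd
  have hy : y ∈ (chartAt (MomModel m n) j.pt).target := mem_chart_target _ _
  have hpt : (h.legInv j.pt.toRed).pt = (jetProj j).pt := h.legInv_pt j.pt
  -- The formula for the fibre derivatives of `ℓ` is available in the chart at the jet itself, hence
  -- the passage from the chart at `jetProj j`.
  have hG : localLegInv h j y =
      chartAt (JetModel m n) (h.legInv j.pt.toRed) (h.legInv j.pt.toRed) := by
    rw [localLegInv_eq h j hy, hyd,
      (chartAt (MomModel m n) j.pt).left_inv (mem_chart_source _ _), Jet1.chartAt_eq hpt]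
  -- At the inverse Legendre transform `∂ℓ/∂uᵅᵢ` equals the momentum `pⁱ_α` of the given point.
  have hvert : ∀ A, fderiv ℝ (localLag η L (jetProj j)) (localLegInv h j y) (0, A) =
      ∑ i, ∑ a, y.2.2 i a * A (stdBasis i) a := by
    intro A
    rw [hG, ← localLag_eq η L hpt, fderiv_localLag_eq_sum hη hL, h.leg_legInv, h.legInv_pt,
      RedMom.fib_toRed (mem_adaptedAt j.pt.pt)]
    rfl
  set d := fderiv ℝ (localLegInv h j) y k with hd
  have hsplit : d = (k.1, 0) + (0, d.2) := by
    rw [Prod.mk_add_mk, add_zero, zero_add]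
    exact Prod.ext (fderiv_localLegInv_fst h j hy k) rfl
  rw [(differentiableAt_localHam_and_fderiv hη hL h j hy).2, ← hd]
  -- The last sum is also the one that the product rule produces from `pⁱ_α Gᵅᵢ`, so the two cancel
  -- in `H`.
  have h2 : fderiv ℝ (localLag η L (jetProj j)) (localLegInv h j y) d =
      fderiv ℝ (localLag η L (jetProj j)) (localLegInv h j y) (k.1, 0) +
        ∑ i, ∑ a, y.2.2 i a * d.2 (stdBasis i) a := by
    conv_lhs => rw [hsplit, map_add, hvert]
  rw [h2]
  simp only [Finset.sum_add_distrib]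
  ring

/-! ### Comparison of the two systems of equations -/

theorem localLegInv_of_legInv_eq (h : IsHyperregular η L) (j : JetMom m n π)
    (hz : h.legInv j.pt.toRed = jetProj j) :
    localLegInv h j (chartAt (MomModel m n) j.pt j.pt) =
      chartAt (JetModel m n) (jetProj j) (jetProj j) := by
  rw [localLegInv_eq h j (mem_chart_target _ _),
    (chartAt (MomModel m n) j.pt).left_inv (mem_chart_source _ _), hz]

/-- A point of `𝓜°π` is determined by its base point and its momenta, and `leg_𝓛` is invertible.
This is the meaning of the Lagrangian equations `pⁱ_α = ∂ℓ/∂uᵅᵢ`. -/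
theorem legInv_eq_iff (h : IsHyperregular η L) (j : JetMom m n π) :
    h.legInv j.pt.toRed = jetProj j ↔
      RedMom.fib (adaptedAt m n π j.pt.pt) (leg η L (jetProj j)) = momCoord j.pt := by
  have h1 : RedMom.fib (adaptedAt m n π j.pt.pt) j.pt.toRed = momCoord j.pt :=
    RedMom.fib_toRed (mem_adaptedAt j.pt.pt)
  constructor
  · intro hz
    rw [← hz, h.leg_legInv, h1]
  · intro hf
    have h2 : leg η L (jetProj j) = j.pt.toRed := by
      rw [← h1] at hf
      have e1 := (RedMom.natBundle m n π).point_fib (adaptedAt m n π j.pt.pt) (leg η L (jetProj j))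
        (mem_adaptedAt j.pt.pt)
      have e2 := (RedMom.natBundle m n π).point_fib (adaptedAt m n π j.pt.pt) j.pt.toRed
        (mem_adaptedAt j.pt.pt)
      rw [← e1, ← e2]
      exact congrArg ((RedMom.natBundle m n π).point (adaptedAt m n π j.pt.pt) j.pt.pt) hf
    rw [← h2, h.legInv_leg]

/-- A jet is determined by its coordinates, and the two jets already lie over the same point of `E`.
This is the meaning of the Hamiltonian equations `uᵅᵢ = ∂H/∂pⁱ_α`. -/
theorem legInv_eq_of_localLegInv (h : IsHyperregular η L) (j : JetMom m n π)
    (hz : ∀ i, (localLegInv h j (chartAt (MomModel m n) j.pt j.pt)).2 (stdBasis i) =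
      (jetFrame j (stdBasis i)).1.2) : h.legInv j.pt.toRed = jetProj j := by
  have hy := mem_chart_target (MomModel m n) j.pt
  have hsrc := legInv_mem_source h j hy
  have hG := localLegInv_eq h j hy
  have hfst := localLegInv_fst h j hy
  rw [(chartAt (MomModel m n) j.pt).left_inv (mem_chart_source _ _)] at hsrc hG
  refine (chartAt (JetModel m n) (jetProj j)).injOn hsrc (mem_chart_source _ _) ?_
  rw [← hG]
  refine Prod.ext hfst ?_
  rw [clm_eq_sum (localLegInv h j (chartAt (MomModel m n) j.pt j.pt)).2,
    clm_eq_sum (chartAt (JetModel m n) (jetProj j) (jetProj j)).2]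
  simp only [hz, jetProj_fib]

theorem lagSubmanifold_eq_hamSubmanifold [IsManifold (𝓡 m) ∞ M] (hη : IsVolumeForm η)
    (hL : ContMDiff 𝓘(ℝ, JetModel m n) 𝓘(ℝ, ℝ) ∞ L) (h : IsHyperregular η L) :
    lagSubmanifold η L = hamSubmanifold h := by
  ext j
  rw [mem_lagSubmanifold_iff hη hL, mem_hamSubmanifold_iff hη hL]
  simp only [tulCovector_apply, hamCovector_apply, fderiv_localHam hη hL h j]
  have hcomm : ∀ w : Rn n, ∑ a, (∑ i, (jetFrame j (stdBasis i)).2.2 i a) * w a =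
      ∑ i, ∑ a, (jetFrame j (stdBasis i)).2.2 i a * w a := by
    intro w
    rw [Finset.sum_comm]
    simp only [Finset.sum_mul]
  simp only [hcomm]
  have hvert := fun A => fderiv_localLag_eq_sum hη hL (jetProj j) A
  constructor
  · intro hlag
    have hz : h.legInv j.pt.toRed = jetProj j := by
      rw [legInv_eq_iff]
      ext i a
      -- The test vector is `∂/∂uᵅᵢ`; it isolates `pⁱ_α = ∂ℓ/∂uᵅᵢ`.
      have h1 := hlag (0, (EuclideanSpace.proj i : Rn m →L[ℝ] ℝ).smulRight (stdBasis a)) rfl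
      rw [hvert] at h1
      rw [sum_mul_smulRight, sum_mul_smulRight] at h1
      simp at h1
      exact h1.symm
    rw [localLegInv_of_legInv_eq h j hz]
    intro k hk
    -- Without a component along the velocities, the equation reduces to `pⁱ_{αi} = ∂ℓ/∂uᵅ`. The
    -- other terms of the Hamiltonian equation agree because the inverse Legendre transform is now
    -- `jetProj j`.
    have h2 := hlag (k.1, 0) hk
    simp only [_root_.zero_apply, PiLp.zero_apply, mul_zero, Finset.sum_const_zero,
      add_zero] at h2
    rw [← h2]
    simp only [jetProj_fib]
  · intro hham
    have hz : h.legInv j.pt.toRed = jetProj j := by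
      refine legInv_eq_of_localLegInv h j fun i => ?_
      ext a
      -- The test vector is `∂/∂pⁱ_α`; its component along `E` is zero, so the term in `ℓ` drops out
      -- and `uᵅᵢ = Gᵅᵢ` remains.
      have h1 := hham (0, 0, Pi.single i (Pi.single a 1)) rfl
      have h0 : (((0 : Adap m n), (0 : Rn m →L[ℝ] Rn n)) : JetModel m n) = 0 := rfl
      dsimp only at h1
      rw [h0, map_zero] at h1
      simpa [Pi.single_apply, ite_apply] using h1.symm
    rw [localLegInv_of_legInv_eq h j hz] at hham
    intro k hk
    -- With no component along the momenta this gives `pⁱ_{αi} = ∂ℓ/∂uᵅ`, both sides carrying a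
    -- minus sign.
    have h2 := hham (k.1, 0) hk
    have h3 : k = (k.1, 0) + (0, k.2) := by simp
    have hf := (legInv_eq_iff h j).1 hz
    -- The velocity part of `dℓ` is given by the Legendre momenta, which equal those of `j.pt` by
    -- `hf`.
    have h4 : fderiv ℝ (localLag η L (jetProj j)) (chartAt (JetModel m n) (jetProj j) (jetProj j)) k
        = fderiv ℝ (localLag η L (jetProj j)) (chartAt (JetModel m n) (jetProj j) (jetProj j))
          (k.1, 0) + ∑ i, ∑ a, momCoord j.pt i a * k.2 (stdBasis i) a := by
      conv_lhs => rw [h3, map_add, hvert]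
      rw [← hf]
      rfl
    rw [h4]
    simp only [Prod.fst_zero, Prod.snd_zero, Pi.zero_apply, zero_mul, Finset.sum_const_zero,
      add_zero, zero_sub, neg_inj] at h2
    rw [h2]

end Legendre

end CFT

end

theorem mainTheorem5 {m n : ℕ} {M E : Type*}
    [TopologicalSpace M] [ChartedSpace (CFT.Rn m) M] [IsManifold (𝓡 m) ∞ M]
    [TopologicalSpace E] [ChartedSpace (CFT.Rn (m + n)) E] [IsManifold (𝓡 (m + n)) ∞ E]
    (π : E → M) [CFT.IsFibration m n π]
    (η : ∀ x : M, TangentSpace (𝓡 m) x [⋀^Fin m]→L[ℝ] ℝ) (hη : CFT.IsVolumeForm η)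
    (L : CFT.Jet1 m n π → ℝ)
    (hL : ContMDiff 𝓘(ℝ, CFT.JetModel m n) 𝓘(ℝ, ℝ) ∞ L)
    (h : CFT.IsHyperregular η L) :
    CFT.lagSubmanifold η L = CFT.hamSubmanifold h :=
  CFT.lagSubmanifold_eq_hamSubmanifold hη hL h
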